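/- Let $d \ge 1$, $\mathbb T^d=\mathbb R^d/\mathbb Z^d$, and let $S:\mathbb R^d\times\mathbb R^d\to\mathbb R$ be a generating function, i.e. a function of class $C^2$ such that (i) $S(x+r,y+r)=S(x,y)$ for all $r\in\mathbb Z^d$ and $x,y\in\mathbb R^d$; (ii) there is a real number $A>0$ such that $\sum_{i,j}\frac{\partial^2 S}{\partial x_i\partial y_j}(x,y)\,\xi_i\xi_j\le -A\|\xi\|^2$ for all $x,y,\xi\in\mathbb R^d$. Write $\partial_1S$ and $\partial_2S$ for the partial differentials of $S$ with respect to its first and second variable. Condition (ii) implies that there is a bijection $\bar F$ of $\mathbb R^d\times(\mathbb R^d)^*$ onto itself defined by $$\bar F(x,p)=(x',p')\iff p=-\partial_1S(x,x')\ \text{ and }\ p'=\partial_2S(x,x'),$$ and by (i) $\bar F$ is a lift of a bijection $F$ of $T^*\mathbb T^d=\mathbb T^d\times(\mathbb R^d)^*$, the twist map generated by $S$; $F$ and $F^{-1}$ are differentiable. For $\omega\in T^*\mathbb T^d$ let $V(\omega)\subset T_\omega T^*\mathbb T^d$ be the kernel of the differential at $\omega$ of the canonical projection $T^*\mathbb T^d\to\mathbb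 T^d$. The map $F$ is *without conjugate points* if $$V(F^n(\omega))\cap DF^n(\omega)\cdot V(\omega)=\{0\}\qquad\text{for all }\omega\in T^*\mathbb T^d\text{ and all }n\in\mathbb Z\setminus\{0\}.$$ For $x,y\in\mathbb R^d$ and an integer $N\ge 2$, the action with fixed endpoints is the function on $(\mathbb R^d)^{N-1}$ given by $$S_{x,y,N}(x_1,\dots,x_{N-1})=\sum_{k=0}^{N-1}S(x_k,x_{k+1}),\qquad x_0=x,\ x_N=y.$$ A sequence $(x_n)_{n\in\mathbb Z}$ in $\mathbb R^d$ is *extremal* if $\partial_2S(x_{n-1},x_n)+\partial_1S(x_n,x_{n+1})=0$ for all $n\in\mathbb Z$. Assume that $F$ is without conjugate points. Then: 1. for all $x,y\in\mathbb R^d$ and every integer $N\ge 2$, the function $S_{x,y,N}$ has a unique critical point, and at that point $S_{x,y,N}$ attains its global minimum; 2. for all $x,y\in\mathbb R^d$ and every integer $N\ge 1$, there is a unique extremal sequence $(x_n)_{n\in\mathbb Z}$ with $x_0=x$ and $x_N=y$. -/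

import Mathlib

open Filter Topology Set

noncomputable section

namespace TwistMap

/-- The Euclidean space `ℝ^d`. -/
abbrev Vec (d : ℕ) : Type := EuclideanSpace ℝ (Fin d)

/-- The dual space `(ℝ^d)^*`. -/
abbrev Covec (d : ℕ) : Type := Vec d →L[ℝ] ℝ

/-- An integer vector, seen in `ℝ^d`. -/
def intVec {d : ℕ} (r : Fin d → ℤ) : Vec d := WithLp.toLp 2 (fun i => (r i : ℝ))

/-- The lattice `ℤ^d` in `ℝ^d`. -/
def intLattice (d : ℕ) : AddSubgroup (Vec d) where
  carrier := {v | ∃ r : Fin d → ℤ, v = intVec r}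
  zero_mem' := ⟨0, by ext i; simp [intVec]⟩
  add_mem' := by
    rintro _ _ ⟨r, rfl⟩ ⟨s, rfl⟩
    exact ⟨r + s, by ext i; simp [intVec]⟩
  neg_mem' := by
    rintro _ ⟨r, rfl⟩
    exact ⟨-r, by ext i; simp [intVec]⟩

/-- The partial differential of `S(x, y)` with respect to `x`. -/
def d₁ {d : ℕ} (S : Vec d × Vec d → ℝ) (x y : Vec d) : Covec d :=
  fderiv ℝ (fun u => S (u, y)) x

/-- The partial differential of `S(x, y)` with respect to `y`. -/
def d₂ {d : ℕ} (S : Vec d × Vec d → ℝ) (x y : Vec d) : Covec d :=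
  fderiv ℝ (fun v => S (x, v)) y

/-- The second order partial derivative `∂²S / ∂x_i ∂y_j` at `(x, y)`. -/
def mixedPartial {d : ℕ} (S : Vec d × Vec d → ℝ) (x y : Vec d) (i j : Fin d) : ℝ :=
  fderiv ℝ (fun u => d₂ S u y (EuclideanSpace.single j 1)) x (EuclideanSpace.single i 1)

/-- Generating functions: functions of class `C²` on `ℝ^d × ℝ^d`, invariant under the diagonal
action of `ℤ^d`, which satisfy the uniform twist condition. -/
structure GeneratingFunction (d : ℕ) where
  /-- the function `S(x, y)` -/
  S : Vec d × Vec d → ℝ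
  contDiff : ContDiff ℝ 2 S
  periodic : ∀ (r : Fin d → ℤ) (x y : Vec d), S (x + intVec r, y + intVec r) = S (x, y)
  twist : ∃ A : ℝ, 0 < A ∧ ∀ (x y ξ : Vec d),
    ∑ i, ∑ j, mixedPartial S x y i j * ξ i * ξ j ≤ -A * ‖ξ‖ ^ 2

/-! ### Actions and extremal sequences -/

/-- The sequence `x_0 = x, x_1, …, x_{N-1}, x_N = y` with interior points given by `z`
(extended by `y` after the index `N`). -/
def path {d : ℕ} (x y : Vec d) (N : ℕ) (z : Fin (N - 1) → Vec d) (k : ℕ) : Vec d :=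
  if k = 0 then x else if h : k - 1 < N - 1 then z ⟨k - 1, h⟩ else y

/-- The action with fixed endpoints `S_{x,y,N}`. -/
def fixedAction {d : ℕ} (S : Vec d × Vec d → ℝ) (x y : Vec d) (N : ℕ)
    (z : Fin (N - 1) → Vec d) : ℝ :=
  ∑ k ∈ Finset.range N, S (path x y N z k, path x y N z (k + 1))

/-- Critical points: the differential vanishes. -/
def IsCriticalPoint {W : Type*} [NormedAddCommGroup W] [NormedSpace ℝ W] (f : W → ℝ) (z : W) :
    Prop :=
  HasFDerivAt f (0 : W →L[ℝ] ℝ) z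

/-- Infinite extremal sequences. -/
def IsExtremal {d : ℕ} (S : Vec d × Vec d → ℝ) (u : ℤ → Vec d) : Prop :=
  ∀ n : ℤ, d₂ S (u (n - 1)) (u n) + d₁ S (u n) (u (n + 1)) = 0

/-! ### The twist condition makes the partial differentials bijective -/

section Bijective

variable {d : ℕ}

lemma bijective_of_twist (G : Vec d → Covec d) (hG : ContDiff ℝ 1 G) (A : ℝ) (hA : 0 < A)
    (h : ∀ y ξ, fderiv ℝ G y ξ ξ ≤ -A * ‖ξ‖ ^ 2) : Function.Bijective G := by
  have hdiff : Differentiable ℝ G := hG.differentiable (by norm_num)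
  have hmono : ∀ a b, (G a - G b) (a - b) ≤ -A * ‖a - b‖ ^ 2 := by
    intro a b
    have hd : ∀ t : ℝ, HasDerivAt (fun t : ℝ => G (b + t • (a - b)) (a - b))
        (fderiv ℝ G (b + t • (a - b)) (a - b) (a - b)) t := by
      intro t
      have h1 : HasDerivAt (fun t : ℝ => b + t • (a - b)) (a - b) t := by
        simpa using ((hasDerivAt_id t).smul_const (a - b)).const_add b
      have h2 := (hdiff (b + t • (a - b))).hasFDerivAt.comp_hasDerivAt t h1
      exact h2.clm_apply (hasDerivAt_const t (a - b)) |>.congr_deriv (by simp)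
    obtain ⟨c, -, hc⟩ := exists_hasDerivAt_eq_slope
      (fun t : ℝ => G (b + t • (a - b)) (a - b)) _ (zero_lt_one' ℝ)
      (fun t _ => (hd t).continuousAt.continuousWithinAt) (fun t _ => hd t)
    have := h (b + c • (a - b)) (a - b)
    rw [hc] at this
    simpa using this
  have hanti : ∀ a b, A * ‖a - b‖ ≤ ‖G a - G b‖ := by
    intro a b
    rcases eq_or_ne a b with rfl | hab
    · simp
    have hpos : 0 < ‖a - b‖ := norm_pos_iff.2 (sub_ne_zero.2 hab)
    have h1 := hmono a b
    have h2 := (G a - G b).le_opNorm (a - b)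
    have h3 := neg_le_abs ((G a - G b) (a - b))
    rw [← Real.norm_eq_abs] at h3
    refine le_of_mul_le_mul_right ?_ hpos
    nlinarith
  have hinj : Function.Injective G := by
    intro a b hab
    have := hanti a b
    rw [hab, sub_self, norm_zero] at this
    have h0 : ‖a - b‖ ≤ 0 := by
      by_contra hc
      push Not at hc
      nlinarith [mul_pos hA hc]
    exact sub_eq_zero.1 (norm_le_zero_iff.1 h0)
  have hlip : AntilipschitzWith (Real.toNNReal A⁻¹) G := by
    refine AntilipschitzWith.of_le_mul_dist fun a b => ?_
    rw [dist_eq_norm, dist_eq_norm, Real.coe_toNNReal _ (inv_pos.2 hA).le,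
      le_inv_mul_iff₀ hA]
    exact hanti a b
  have hclosed : IsClosed (range G) := by
    have hp : IsProperMap G := by
      rw [isProperMap_iff_tendsto_cocompact]
      refine ⟨hG.continuous, ?_⟩
      have := hlip.tendsto_cobounded
      rwa [Metric.cobounded_eq_cocompact, Metric.cobounded_eq_cocompact] at this
    exact hp.isClosedMap.isClosed_range
  have hopen : IsOpen (range G) := by
    have hequiv : ∀ y, ∃ e : Vec d ≃L[ℝ] Covec d, (e : Vec d →L[ℝ] Covec d) = fderiv ℝ G y := by
      intro y
      have hi : Function.Injective (fderiv ℝ G y : Vec d →ₗ[ℝ] Covec d) := by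
        rw [injective_iff_map_eq_zero]
        intro ξ hξ
        have h1 := h y ξ
        rw [show fderiv ℝ G y ξ = 0 from hξ] at h1
        have h2 : ‖ξ‖ ^ 2 ≤ 0 := by
          by_contra hc
          push Not at hc
          simp only [zero_apply] at h1
          nlinarith [mul_pos hA hc]
        have h3 : ‖ξ‖ ^ 2 = 0 := le_antisymm h2 (by positivity)
        simpa using h3
      have hdim : Module.finrank ℝ (Vec d) = Module.finrank ℝ (Covec d) :=
        (InnerProductSpace.toDual ℝ (Vec d)).toLinearEquiv.finrank_eq
      refine ⟨(LinearEquiv.ofInjectiveOfFinrankEq _ hi hdim).toContinuousLinearEquiv, ?_⟩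
      ext1 v
      rfl
    choose e he using hequiv
    refine (isOpenMap_of_hasStrictFDerivAt_equiv (f' := e) fun y => ?_).isOpen_range
    rw [he]
    exact hG.contDiffAt.hasStrictFDerivAt (by norm_num)
  refine ⟨hinj, range_eq_univ.1 ?_⟩
  exact IsClopen.eq_univ ⟨hclosed, hopen⟩ (range_nonempty G)

lemma d₁_eq {S : Vec d × Vec d → ℝ} (hS : ContDiff ℝ 2 S) (x y : Vec d) :
    d₁ S x y = (fderiv ℝ S (x, y)).comp (ContinuousLinearMap.inl ℝ (Vec d) (Vec d)) :=
  ((hS.differentiable (by norm_num) (x, y)).hasFDerivAt.comp x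
    (hasFDerivAt_prodMk_left x y)).fderiv

lemma d₂_eq {S : Vec d × Vec d → ℝ} (hS : ContDiff ℝ 2 S) (x y : Vec d) :
    d₂ S x y = (fderiv ℝ S (x, y)).comp (ContinuousLinearMap.inr ℝ (Vec d) (Vec d)) :=
  ((hS.differentiable (by norm_num) (x, y)).hasFDerivAt.comp y
    (hasFDerivAt_prodMk_right x y)).fderiv

lemma contDiff_d₁ {S : Vec d × Vec d → ℝ} (hS : ContDiff ℝ 2 S) :
    ContDiff ℝ 1 (fun z : Vec d × Vec d => d₁ S z.1 z.2) := by
  simp only [d₁_eq hS]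
  exact (hS.fderiv_right (m := 1) (by norm_num)).clm_comp contDiff_const

lemma contDiff_d₂ {S : Vec d × Vec d → ℝ} (hS : ContDiff ℝ 2 S) :
    ContDiff ℝ 1 (fun z : Vec d × Vec d => d₂ S z.1 z.2) := by
  simp only [d₂_eq hS]
  exact (hS.fderiv_right (m := 1) (by norm_num)).clm_comp contDiff_const

lemma fderiv_d₁ {S : Vec d × Vec d → ℝ} (hS : ContDiff ℝ 2 S) (x y ξ η : Vec d) :
    fderiv ℝ (fun v => d₁ S x v) y η ξ = fderiv ℝ (fderiv ℝ S) (x, y) (0, η) (ξ, 0) := by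
  have hD : Differentiable ℝ (fderiv ℝ S) :=
    (hS.fderiv_right (m := 1) (by norm_num)).differentiable (by norm_num)
  have h1 := (hD (x, y)).hasFDerivAt.comp (f := fun v : Vec d => (x, v)) y
    (hasFDerivAt_prodMk_right x y)
  have h2 := h1.clm_comp
    (hasFDerivAt_const (ContinuousLinearMap.inl ℝ (Vec d) (Vec d)) y)
  simp only [d₁_eq hS]
  erw [h2.fderiv]
  simp

lemma fderiv_d₂ {S : Vec d × Vec d → ℝ} (hS : ContDiff ℝ 2 S) (x y ξ η : Vec d) :
    fderiv ℝ (fun u => d₂ S u y) x ξ η = fderiv ℝ (fderiv ℝ S) (x, y) (ξ, 0) (0, η) := by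
  have hD : Differentiable ℝ (fderiv ℝ S) :=
    (hS.fderiv_right (m := 1) (by norm_num)).differentiable (by norm_num)
  have h1 := (hD (x, y)).hasFDerivAt.comp (f := fun u : Vec d => (u, y)) x
    (hasFDerivAt_prodMk_left x y)
  have h2 := h1.clm_comp
    (hasFDerivAt_const (ContinuousLinearMap.inr ℝ (Vec d) (Vec d)) x)
  simp only [d₂_eq hS]
  erw [h2.fderiv]
  simp

lemma sum_mixedPartial {S : Vec d × Vec d → ℝ} (hS : ContDiff ℝ 2 S) (x y ξ : Vec d) :
    ∑ i, ∑ j, mixedPartial S x y i j * ξ i * ξ j = fderiv ℝ (fun u => d₂ S u y) x ξ ξ := by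
  have hdiff : DifferentiableAt ℝ (fun u => d₂ S u y) x :=
    ((contDiff_d₂ hS).comp (contDiff_id.prodMk contDiff_const)).differentiable
      (by norm_num) x
  have hm : ∀ i j, mixedPartial S x y i j = fderiv ℝ (fun u => d₂ S u y) x
      (EuclideanSpace.single i 1) (EuclideanSpace.single j 1) := by
    intro i j
    have := hdiff.hasFDerivAt.clm_apply
      (hasFDerivAt_const (EuclideanSpace.single j (1 : ℝ)) x)
    unfold mixedPartial
    rw [this.fderiv]
    simp
  have hξ : ξ = ∑ i, ξ i • EuclideanSpace.single i (1 : ℝ) := by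
    ext k
    simp [Finset.sum_apply, Pi.single_apply]
  conv_rhs => rw [hξ]
  simp only [map_sum, map_smul, sum_apply, smul_apply,
    smul_eq_mul, hm, Finset.mul_sum]
  rw [Finset.sum_comm]
  refine Finset.sum_congr rfl fun i _ => Finset.sum_congr rfl fun j _ => ?_
  ring

end Bijective

namespace GeneratingFunction

variable {d : ℕ} (G : GeneratingFunction d)

lemma bijective_d₂ (y : Vec d) : Function.Bijective (fun x => d₂ G.S x y) := by
  obtain ⟨A, hA, h⟩ := G.twist
  refine bijective_of_twist _
    ((contDiff_d₂ G.contDiff).comp (contDiff_id.prodMk contDiff_const)) A hA fun x ξ => ?_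
  rw [← sum_mixedPartial G.contDiff]
  exact h x y ξ

lemma bijective_d₁ (x : Vec d) : Function.Bijective (fun y => d₁ G.S x y) := by
  obtain ⟨A, hA, h⟩ := G.twist
  refine bijective_of_twist _
    ((contDiff_d₁ G.contDiff).comp (contDiff_const.prodMk contDiff_id)) A hA fun y ξ => ?_
  have hsymm : IsSymmSndFDerivAt ℝ G.S (x, y) :=
    G.contDiff.contDiffAt.isSymmSndFDerivAt (by simp)
  have := h x y ξ
  rw [sum_mixedPartial G.contDiff, fderiv_d₂ G.contDiff] at this
  rw [fderiv_d₁ G.contDiff, hsymm.eq]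
  exact this

/-- `x'` such that `p = -∂₁S(x, x')`. -/
def next (x : Vec d) (p : Covec d) : Vec d := ((G.bijective_d₁ x).surjective (-p)).choose

lemma d₁_next (x : Vec d) (p : Covec d) : d₁ G.S x (G.next x p) = -p :=
  ((G.bijective_d₁ x).surjective (-p)).choose_spec

/-- `x` such that `p' = ∂₂S(x, x')`. -/
def prev (x' : Vec d) (p' : Covec d) : Vec d := ((G.bijective_d₂ x').surjective p').choose

lemma d₂_prev (x' : Vec d) (p' : Covec d) : d₂ G.S (G.prev x' p') x' = p' :=
  ((G.bijective_d₂ x').surjective p').choose_spec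

/-- The lifted twist map `F̄` of `ℝ^d × (ℝ^d)^*`: it sends `(x, p)` to `(x', p')`, where
`p = -∂₁S(x, x')` and `p' = ∂₂S(x, x')`. -/
def liftedMap : Equiv.Perm (Vec d × Covec d) where
  toFun z := (G.next z.1 z.2, d₂ G.S z.1 (G.next z.1 z.2))
  invFun w := (G.prev w.1 w.2, -d₁ G.S (G.prev w.1 w.2) w.1)
  left_inv := by
    rintro ⟨x, p⟩
    have h : G.prev (G.next x p) (d₂ G.S x (G.next x p)) = x :=
      (G.bijective_d₂ (G.next x p)).injective (G.d₂_prev _ _)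
    simp [h, G.d₁_next]
  right_inv := by
    rintro ⟨x', p'⟩
    have h : G.next (G.prev x' p') (-d₁ G.S (G.prev x' p') x') = x' :=
      (G.bijective_d₁ (G.prev x' p')).injective (by simp [G.d₁_next])
    simp [h, G.d₂_prev]

/-- The implicit definition of the lifted twist map. -/
lemma liftedMap_eq_iff (x x' : Vec d) (p p' : Covec d) :
    G.liftedMap (x, p) = (x', p') ↔ p = -d₁ G.S x x' ∧ p' = d₂ G.S x x' := by
  constructor
  · intro h
    obtain ⟨rfl, rfl⟩ := Prod.mk.inj h
    exact ⟨by rw [G.d₁_next, neg_neg], rfl⟩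
  · rintro ⟨rfl, rfl⟩
    have h : G.next x (-d₁ G.S x x') = x' :=
      (G.bijective_d₁ x).injective (by simp [G.d₁_next])
    simp [liftedMap, h]

lemma d₁_periodic (r : Fin d → ℤ) (x y : Vec d) :
    d₁ G.S (x + intVec r) (y + intVec r) = d₁ G.S x y := by
  unfold d₁
  rw [← fderiv_comp_add_right (f := fun u => G.S (u, y + intVec r))]
  simp only [G.periodic]

lemma d₂_periodic (r : Fin d → ℤ) (x y : Vec d) :
    d₂ G.S (x + intVec r) (y + intVec r) = d₂ G.S x y := by
  unfold d₂
  rw [← fderiv_comp_add_right (f := fun v => G.S (x + intVec r, v))]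
  simp only [G.periodic]

lemma liftedMap_add (r : Fin d → ℤ) (z : Vec d × Covec d) :
    G.liftedMap (z.1 + intVec r, z.2)
      = ((G.liftedMap z).1 + intVec r, (G.liftedMap z).2) := by
  obtain ⟨h1, h2⟩ := (G.liftedMap_eq_iff z.1 (G.liftedMap z).1 z.2 (G.liftedMap z).2).1 rfl
  rw [liftedMap_eq_iff, d₁_periodic, d₂_periodic]
  exact ⟨h1, h2⟩

end GeneratingFunction

/-! ### The cotangent bundle of the torus -/

/-- The torus `𝕋^d = ℝ^d / ℤ^d`. -/
abbrev Torus (d : ℕ) : Type := Vec d ⧸ intLattice d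

/-- The cotangent bundle `T^*𝕋^d = 𝕋^d × (ℝ^d)^*`. -/
abbrev CotTorus (d : ℕ) : Type := Torus d × Covec d

/-- The covering map `ℝ^d × (ℝ^d)^* → T^*𝕋^d`. -/
def proj {d : ℕ} (z : Vec d × Covec d) : CotTorus d := ((z.1 : Torus d), z.2)

/-- A lift of a point of `T^*𝕋^d`. -/
def someLift {d : ℕ} (ω : CotTorus d) : Vec d × Covec d := (Quotient.out ω.1, ω.2)

lemma proj_someLift {d : ℕ} (ω : CotTorus d) : proj (someLift ω) = ω :=
  Prod.ext (Quotient.out_eq' ω.1) rfl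

lemma proj_eq_iff {d : ℕ} (z w : Vec d × Covec d) :
    proj z = proj w ↔ ∃ r : Fin d → ℤ, w = (z.1 + intVec r, z.2) := by
  obtain ⟨x, p⟩ := z
  obtain ⟨y, q⟩ := w
  simp only [proj, Prod.mk.injEq, QuotientAddGroup.eq]
  constructor
  · rintro ⟨⟨r, hr⟩, rfl⟩
    exact ⟨r, by rw [← hr]; abel, rfl⟩
  · rintro ⟨r, rfl, rfl⟩
    exact ⟨⟨r, by abel⟩, rfl⟩

lemma GeneratingFunction.proj_liftedMap_congr {d : ℕ} (G : GeneratingFunction d)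
    {z w : Vec d × Covec d} (h : proj z = proj w) :
    proj (G.liftedMap z) = proj (G.liftedMap w) := by
  obtain ⟨r, rfl⟩ := (proj_eq_iff z w).1 h
  exact (proj_eq_iff _ _).2 ⟨r, G.liftedMap_add r z⟩

lemma GeneratingFunction.proj_liftedMap_symm_congr {d : ℕ} (G : GeneratingFunction d)
    {z w : Vec d × Covec d} (h : proj z = proj w) :
    proj (G.liftedMap.symm z) = proj (G.liftedMap.symm w) := by
  obtain ⟨r, rfl⟩ := (proj_eq_iff z w).1 h
  refine (proj_eq_iff _ _).2 ⟨r, ?_⟩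
  rw [Equiv.symm_apply_eq, G.liftedMap_add, Equiv.apply_symm_apply]

/-- The twist map `F` of `T^*𝕋^d`, the map whose lift is `F̄`. -/
def GeneratingFunction.twistMap {d : ℕ} (G : GeneratingFunction d) :
    Equiv.Perm (CotTorus d) where
  toFun ω := proj (G.liftedMap (someLift ω))
  invFun ω := proj (G.liftedMap.symm (someLift ω))
  left_inv ω := by
    beta_reduce
    rw [G.proj_liftedMap_symm_congr (proj_someLift _), Equiv.symm_apply_apply, proj_someLift]
  right_inv ω := by
    beta_reduce
    rw [G.proj_liftedMap_congr (proj_someLift _), Equiv.apply_symm_apply, proj_someLift]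

lemma GeneratingFunction.twistMap_proj {d : ℕ} (G : GeneratingFunction d)
    (z : Vec d × Covec d) : G.twistMap (proj z) = proj (G.liftedMap z) :=
  G.proj_liftedMap_congr (proj_someLift _)

/-- `L` is the differential at `ω` of the map `Φ` of the manifold `T^*𝕋^d` to itself. The smooth
structure of `T^*𝕋^d` is the one that makes the covering map `proj` a local diffeomorphism; its
differential identifies every tangent space with `ℝ^d × (ℝ^d)^*`, independently of the
lift, and in these coordinates `L` is the differential of a local lift of `Φ`. -/
def HasDifferentialAt {d : ℕ} (Φ : CotTorus d → CotTorus d) (ω : CotTorus d)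
    (L : Vec d × Covec d →L[ℝ] Vec d × Covec d) : Prop :=
  ∃ (z : Vec d × Covec d) (Ψ : Vec d × Covec d → Vec d × Covec d),
    proj z = ω ∧ (∀ᶠ w in 𝓝 z, proj (Ψ w) = Φ (proj w)) ∧ HasFDerivAt Ψ L z

/-- The differential does not depend on the lifts. -/
lemma HasDifferentialAt.unique {d : ℕ} {Φ : CotTorus d → CotTorus d} {ω : CotTorus d}
    {L L' : Vec d × Covec d →L[ℝ] Vec d × Covec d}
    (h : HasDifferentialAt Φ ω L) (h' : HasDifferentialAt Φ ω L') : L = L' := by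
  obtain ⟨z, Ψ, hz, hΨ, hL⟩ := h
  obtain ⟨z', Ψ', hz', hΨ', hL'⟩ := h'
  obtain ⟨r, rfl⟩ := (proj_eq_iff z z').1 (hz.trans hz'.symm)
  set T : Vec d × Covec d := (intVec r, 0) with hT
  have hzT : ((z.1 + intVec r, z.2) : Vec d × Covec d) = z + T := by ext <;> simp [hT]
  rw [hzT] at hΨ' hL'
  have hL'' : HasFDerivAt (fun w => Ψ' (w + T)) L' z := by
    exact hL'.comp (f := fun w => w + T) z ((hasFDerivAt_id z).add_const T)
  have ht : Tendsto (fun w : Vec d × Covec d => w + T) (𝓝 z) (𝓝 (z + T)) :=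
    (continuous_id.add continuous_const).tendsto z
  have hpT : ∀ w, proj (w + T) = proj w := fun w =>
    ((proj_eq_iff _ _).2 ⟨r, by ext <;> simp [hT]⟩ : proj w = proj (w + T)).symm
  have hev : ∀ᶠ w in 𝓝 z, ∃ s : Fin d → ℤ, Ψ' (w + T) - Ψ w = (intVec s, 0) := by
    filter_upwards [hΨ, ht.eventually hΨ'] with w h1 h2
    rw [hpT, ← h1] at h2
    obtain ⟨s, hs⟩ := (proj_eq_iff _ _).1 h2.symm
    exact ⟨s, by rw [hs]; ext <;> simp⟩
  obtain ⟨s₀, hs₀⟩ := hev.self_of_nhds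
  have hc : ContinuousAt (fun w => Ψ' (w + T) - Ψ w) z := hL''.continuousAt.sub hL.continuousAt
  have hnear := Metric.continuousAt_iff.1 hc 1 one_pos
  obtain ⟨δ, hδ, hnear⟩ := hnear
  have hconst : (fun w => Ψ' (w + T)) =ᶠ[𝓝 z] fun w => Ψ w + (intVec s₀, 0) := by
    filter_upwards [hev, Metric.ball_mem_nhds z hδ] with w hw hb
    obtain ⟨s, hs⟩ := hw
    have h1 := hnear hb
    rw [hs, hs₀, Prod.dist_eq] at h1
    have h2 : dist (intVec s) (intVec s₀) < 1 := lt_of_le_of_lt (le_max_left _ _) h1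
    have h3 : s = s₀ := by
      funext i
      have h4 : ‖(intVec s - intVec s₀ : Vec d) i‖ ≤ _ := PiLp.norm_apply_le (intVec s - intVec s₀) i
      rw [← dist_eq_norm] at h4
      have h5 := h4.trans_lt h2
      simp only [intVec, PiLp.sub_apply, Real.norm_eq_abs] at h5
      have h6 : |s i - s₀ i| < 1 := by exact_mod_cast h5
      rw [Int.abs_lt_one_iff] at h6
      omega
    rw [← h3, ← hs]; abel
  exact (hL.add_const _).unique (hL''.congr_of_eventuallyEq hconst.symm)

/-- The vertical space: the kernel of the differential of the canonical projection
`π : T^*𝕋^d → 𝕋^d`, which is `(v, q) ↦ v` for every base point, once the tangent spaces are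
identified with `ℝ^d × (ℝ^d)^*` and `ℝ^d`. -/
def vertical {d : ℕ} (_ω : CotTorus d) : Submodule ℝ (Vec d × Covec d) :=
  LinearMap.ker (LinearMap.fst ℝ (Vec d) (Covec d))

/-- `F` is without conjugate points: `V(F^n(ω)) ∩ DF^n(ω)·V(ω) = {0}` for all `ω` and all
integers `n ≠ 0`. -/
def GeneratingFunction.NoConjugatePoints {d : ℕ} (G : GeneratingFunction d) : Prop :=
  ∀ (ω : CotTorus d) (n : ℤ), n ≠ 0 → ∀ L : Vec d × Covec d →L[ℝ] Vec d × Covec d,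
    HasDifferentialAt (⇑(G.twistMap ^ n)) ω L →
      vertical ((G.twistMap ^ n) ω) ⊓ (vertical ω).map (L : Vec d × Covec d →ₗ[ℝ] Vec d × Covec d)
        = ⊥

end TwistMap

end

/-! Along an orbit of `F̄`, the second differential of the action with fixed endpoints is a
quadratic form on interior variations. By summation by parts, its kernel consists of the Jacobi
fields that vanish at both ends. Such a field is the projection of an orbit of the linearized map
that starts vertical and ends vertical, so the absence of conjugate points makes every one of these
forms nondegenerate (`NoConjugatePoints.eq_zero_of_actionHessian`).

The forms depend continuously on the initial condition `(x, p)`, with both endpoints left free, and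
phase space is connected; hence the index is constant. The twist condition makes the action coercive
(`tendsto_fixedAction`), so a minimum exists, and the form there is positive semidefinite. All the
forms are therefore positive definite (`posDef_of_preconnected`): every critical point of every
action is a nondegenerate local minimum.

A coercive function with this property has only one critical point (`eq_of_critical`). Gradient
descent attracts each point to some critical point; the basins of distinct minima are open and
disjoint, and a segment joining two minima would be covered by them, against connectedness. The
statement on extremal sequences follows, since an extremal sequence is an orbit and is determined by
two consecutive points. -/

noncomputable section

namespace TwistMap

/-! ### Positive quadratic forms and constancy of the index -/

section Forms

variable {E : Type*} [NormedAddCommGroup E] [NormedSpace ℝ E]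

/-- A vector isotropic for a positive semidefinite symmetric form lies in its kernel. -/
lemma apply_eq_zero_of_isotropic (B : E →L[ℝ] E →L[ℝ] ℝ) (hsymm : ∀ v w, B v w = B w v)
    (hB : ∀ v, 0 ≤ B v v) {v : E} (hv : B v v = 0) : B v = 0 := by
  ext w
  have key : ∀ t : ℝ, 0 ≤ 2 * t * B v w + B w w * t ^ 2 := by
    intro t
    have := hB (v + t • w)
    simp only [map_add, map_smul, add_apply, smul_apply,
      smul_eq_mul, hv, hsymm w v] at this
    nlinarith
  by_contra h
  have h' : B v w ≠ 0 := h
  have hw := hB w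
  -- Nearly the minimizer of the quadratic in `t`; the `+ 1` covers the case `B w w = 0`.
  have h1 := key (-(B v w) / (B w w + 1))
  have h2 : 2 * (-(B v w) / (B w w + 1)) * B v w + B w w * (-(B v w) / (B w w + 1)) ^ 2
      = -((B v w) ^ 2 * (B w w + 2) / (B w w + 1) ^ 2) := by
    have : B w w + 1 ≠ 0 := by positivity
    field_simp
    ring
  rw [h2] at h1
  have : 0 < (B v w) ^ 2 * (B w w + 2) / (B w w + 1) ^ 2 := by positivity
  linarith

variable [FiniteDimensional ℝ E]

/-- Compactness of the unit sphere gives the constant, and homogeneity extends the bound to all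
vectors. -/
lemma exists_le_of_posDef (B : E →L[ℝ] E →L[ℝ] ℝ) (hB : ∀ v, v ≠ 0 → 0 < B v v) :
    ∃ m > 0, ∀ v, m * ‖v‖ ^ 2 ≤ B v v := by
  have hc : IsCompact (Metric.sphere (0 : E) 1) := isCompact_sphere 0 1
  have hcont : Continuous fun v => B v v := by fun_prop
  obtain ⟨m, hm, hle⟩ : ∃ m > 0, ∀ v ∈ Metric.sphere (0 : E) 1, m ≤ B v v := by
    rcases (Metric.sphere (0 : E) 1).eq_empty_or_nonempty with he | hne
    · exact ⟨1, one_pos, by simp [he]⟩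
    · obtain ⟨v, hv, hmin⟩ := hc.exists_isMinOn hne hcont.continuousOn
      refine ⟨B v v, hB v ?_, fun w hw => hmin hw⟩
      rintro rfl
      simp at hv
  refine ⟨m, hm, fun v => ?_⟩
  rcases eq_or_ne v 0 with rfl | hv
  · simp
  have hn : 0 < ‖v‖ := norm_pos_iff.2 hv
  have := hle (‖v‖⁻¹ • v) (by simp [norm_smul, hn.ne'])
  simp only [map_smul, smul_apply, smul_eq_mul] at this
  calc m * ‖v‖ ^ 2 ≤ (‖v‖⁻¹ * (‖v‖⁻¹ * B v v)) * ‖v‖ ^ 2 := by gcongr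
    _ = B v v := by field_simp

lemma eventually_norm_sub_lt {X F : Type*} [TopologicalSpace X] [SeminormedAddCommGroup F]
    {f : X → F} {x : X} (hf : ContinuousAt f x) {e : ℝ} (he : 0 < e) :
    ∀ᶠ y in 𝓝 x, ‖f y - f x‖ < e := by
  simpa only [dist_eq_norm] using Metric.tendsto_nhds.1 hf.tendsto e he

/-- A perturbation of operator norm below half the coercivity constant costs at most half of it. The
bound is uniform in the vector, which makes definiteness an open condition. -/
lemma eventually_posDef {X : Type*} [TopologicalSpace X] {B : X → E →L[ℝ] E →L[ℝ] ℝ} {x : X}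
    (hB : ContinuousAt B x) (hx : ∀ v, v ≠ 0 → 0 < B x v v) :
    ∃ m > 0, ∀ᶠ y in 𝓝 x, ∀ v, m * ‖v‖ ^ 2 ≤ B y v v := by
  obtain ⟨m, hm, h⟩ := exists_le_of_posDef (B x) hx
  refine ⟨m / 2, by positivity, ?_⟩
  filter_upwards [eventually_norm_sub_lt (F := E →L[ℝ] E →L[ℝ] ℝ) (f := B) (x := x) hB
    (half_pos hm)] with y hy v
  have h1 := (B y - B x).le_opNorm₂ v v
  have h2 := neg_abs_le ((B y - B x) v v)
  rw [← Real.norm_eq_abs] at h2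
  have h3 : ‖B y - B x‖ * ‖v‖ * ‖v‖ ≤ m / 2 * ‖v‖ * ‖v‖ := by gcongr
  have h4 := h v
  simp only [sub_apply] at h1 h2
  nlinarith

/-- The index of a continuous family of nondegenerate forms is locally constant; only the case of
index zero is needed. -/
lemma posDef_of_preconnected {X : Type*} [TopologicalSpace X] [PreconnectedSpace X]
    (B : X → E →L[ℝ] E →L[ℝ] ℝ) (hB : Continuous B) (hsymm : ∀ x v w, B x v w = B x w v)
    (hnd : ∀ x v, B x v = 0 → v = 0) {x₀ : X} (h₀ : ∀ v, 0 ≤ B x₀ v v) (x : X) (v : E)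
    (hv : v ≠ 0) : 0 < B x v v := by
  set T : Set X := {x | ∀ v, 0 ≤ B x v v} with hT
  -- Semidefiniteness is closed and definiteness is open; nondegeneracy identifies the two, so `T`
  -- is clopen.
  have hpos : ∀ x ∈ T, ∀ v, v ≠ 0 → 0 < B x v v := fun x hx v hv =>
    lt_of_le_of_ne (hx v) fun h =>
      hv (hnd x v (apply_eq_zero_of_isotropic (B x) (hsymm x) hx h.symm))
  have hclosed : IsClosed T := by
    rw [hT, ofPred_forall]
    exact isClosed_iInter fun v => isClosed_le continuous_const (by fun_prop)
  have hopen : IsOpen T := by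
    rw [isOpen_iff_mem_nhds]
    intro x hx
    obtain ⟨m, hm, h⟩ := eventually_posDef hB.continuousAt (hpos x hx)
    filter_upwards [h] with y hy v
    exact le_trans (by positivity) (hy v)
  have : T = univ := IsClopen.eq_univ ⟨hclosed, hopen⟩ ⟨x₀, h₀⟩
  exact hpos x (this ▸ mem_univ x) v hv

end Forms

/-! ### Second-order conditions at critical points -/

section Critical

variable {E : Type*} [NormedAddCommGroup E] [NormedSpace ℝ E]

lemma hasDerivAt_lineMap {f : E → ℝ} (hf : Differentiable ℝ f) (a v : E) (t : ℝ) :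
    HasDerivAt (fun t : ℝ => f (a + t • v)) (fderiv ℝ f (a + t • v) v) t := by
  have h1 : HasDerivAt (fun t : ℝ => a + t • v) v t := by
    simpa using ((hasDerivAt_id t).smul_const v).const_add a
  exact (hf (a + t • v)).hasFDerivAt.comp_hasDerivAt t h1

lemma exists_sub_eq_fderiv {f : E → ℝ} (hf : Differentiable ℝ f) (a v : E) :
    ∃ t ∈ Ioo (0 : ℝ) 1, f (a + v) - f a = fderiv ℝ f (a + t • v) v := by
  obtain ⟨c, hc, h⟩ := exists_hasDerivAt_eq_slope (fun t : ℝ => f (a + t • v)) _ (zero_lt_one' ℝ)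
    (fun t _ => (hasDerivAt_lineMap hf a v t).continuousAt.continuousWithinAt)
    (fun t _ => hasDerivAt_lineMap hf a v t)
  exact ⟨c, hc, by rw [h]; simp⟩

lemma exists_fderiv_sub_eq {f : E → ℝ} (hf : ContDiff ℝ 2 f) (a v : E) :
    ∃ t ∈ Ioo (0 : ℝ) 1,
      fderiv ℝ f (a + v) v - fderiv ℝ f a v = fderiv ℝ (fderiv ℝ f) (a + t • v) v v := by
  have hD : Differentiable ℝ (fderiv ℝ f) :=
    (hf.fderiv_right (m := 1) (by norm_num)).differentiable (by norm_num)
  obtain ⟨t, ht, h⟩ := exists_sub_eq_fderiv (f := fun z => fderiv ℝ f z v)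
    (hD.clm_apply (differentiable_const v)) a v
  refine ⟨t, ht, h.trans ?_⟩
  rw [((hD (a + t • v)).hasFDerivAt.clm_apply (hasFDerivAt_const v _)).fderiv]
  simp

/-- The Hessian is positive semidefinite at a minimum. -/
lemma hessian_nonneg_of_min {f : E → ℝ} (hf : ContDiff ℝ 2 f) {a : E} (ha : ∀ z, f a ≤ f z)
    (v : E) : 0 ≤ fderiv ℝ (fderiv ℝ f) a v v := by
  by_contra! hneg
  have hcrit : fderiv ℝ f a = 0 :=
    IsLocalMin.fderiv_eq_zero (Filter.Eventually.of_forall ha)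
  have hD2 : Continuous (fderiv ℝ (fderiv ℝ f)) :=
    (hf.fderiv_right (m := 1) (by norm_num)).continuous_fderiv (by norm_num)
  have hc : Continuous fun t : ℝ => fderiv ℝ (fderiv ℝ f) (a + t • v) v v := by fun_prop
  have hev : ∀ᶠ t : ℝ in 𝓝 0, fderiv ℝ (fderiv ℝ f) (a + t • v) v v < 0 :=
    hc.continuousAt.eventually_lt continuousAt_const (by simpa using hneg)
  obtain ⟨δ, hδ, h⟩ := Metric.eventually_nhds_iff.1 hev
  have hdiff := hf.differentiable (by norm_num)
  -- Two mean value theorems, for `f` and then for its differential, express the increment of `f` as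
  -- a positive multiple of a second derivative at a point where it is still negative.
  obtain ⟨s, hs, h1⟩ := exists_sub_eq_fderiv hdiff a ((δ / 2) • v)
  obtain ⟨t, ht, h2⟩ := exists_fderiv_sub_eq hf a (s • (δ / 2) • v)
  have h3 := ha (a + (δ / 2) • v)
  simp only [hcrit, map_smul, smul_eq_mul, zero_apply,
    smul_apply, mul_zero, sub_zero] at h1 h2
  rw [smul_smul, smul_smul] at h2
  have h4 := h (y := t * (s * (δ / 2))) (by
    rw [dist_zero_right, Real.norm_eq_abs, abs_of_pos (mul_pos ht.1 (mul_pos hs.1 (by positivity)))]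
    have : t * s ≤ 1 := mul_le_one₀ ht.2.le hs.1.le hs.2.le
    nlinarith)
  rw [smul_smul] at h1
  have hp : 0 < s * (δ / 2) := mul_pos hs.1 (by positivity)
  have h5 : fderiv ℝ f (a + (s * (δ / 2)) • v) v < 0 := by
    have h6 : (s * (δ / 2)) * fderiv ℝ f (a + (s * (δ / 2)) • v) v
        = (s * (δ / 2)) * ((s * (δ / 2)) *
          fderiv ℝ (fderiv ℝ f) (a + (t * (s * (δ / 2))) • v) v v) := by
      linarith
    rw [mul_left_cancel₀ hp.ne' h6]
    exact mul_neg_of_pos_of_neg hp h4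
  nlinarith

/-- Near a nondegenerate minimum there is no other critical point, and the minimum is strict. -/
lemma exists_ball_of_posDef [FiniteDimensional ℝ E] {f : E → ℝ} (hf : ContDiff ℝ 2 f) {a : E}
    (hcrit : fderiv ℝ f a = 0) (ha : ∀ v, v ≠ 0 → 0 < fderiv ℝ (fderiv ℝ f) a v v) :
    ∃ r > 0, ∀ z, ‖z - a‖ ≤ r → z ≠ a → fderiv ℝ f z ≠ 0 ∧ f a < f z := by
  have hD2 : Continuous (fderiv ℝ (fderiv ℝ f)) :=
    (hf.fderiv_right (m := 1) (by norm_num)).continuous_fderiv (by norm_num)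
  obtain ⟨m, hm, hev⟩ := eventually_posDef hD2.continuousAt ha
  obtain ⟨δ, hδ, h⟩ := Metric.eventually_nhds_iff.1 hev
  -- The radial derivative is positive on the punctured ball. This excludes other critical points
  -- and makes `f` increase along rays from `a`.
  have key : ∀ v, ‖v‖ < δ → v ≠ 0 → 0 < fderiv ℝ f (a + v) v := by
    intro v hv hv0
    obtain ⟨t, ht, h2⟩ := exists_fderiv_sub_eq hf a v
    rw [hcrit, zero_apply, sub_zero] at h2
    rw [h2]
    have hn : 0 < ‖v‖ := norm_pos_iff.2 hv0
    refine lt_of_lt_of_le (by positivity) (h ?_ v)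
    rw [dist_eq_norm, add_sub_cancel_left, norm_smul, Real.norm_eq_abs, abs_of_pos ht.1]
    nlinarith [ht.2]
  refine ⟨δ / 2, by positivity, fun z hz hza => ⟨fun h0 => ?_, ?_⟩⟩
  · have := key (z - a) (by linarith) (sub_ne_zero.2 hza)
    rw [add_sub_cancel, h0] at this
    simp at this
  · obtain ⟨t, ht, h1⟩ := exists_sub_eq_fderiv (hf.differentiable (by norm_num)) a (z - a)
    rw [add_sub_cancel] at h1
    have := key (t • (z - a)) (by
      rw [norm_smul, Real.norm_eq_abs, abs_of_pos ht.1]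
      nlinarith [ht.2, norm_nonneg (z - a), ht.1]) (smul_ne_zero ht.1.ne' (sub_ne_zero.2 hza))
    rw [map_smul, smul_eq_mul] at this
    have := pos_of_mul_pos_right this ht.1.le
    linarith

end Critical

/-! ### Gradient descent and uniqueness of the critical point -/

section Descent

variable {E : Type*} [NormedAddCommGroup E] [InnerProductSpace ℝ E] [FiniteDimensional ℝ E]

/-- One step of the gradient descent with step size `h`. -/
def descentStep (f : E → ℝ) (h : ℝ) (z : E) : E :=
  z - h • (InnerProductSpace.toDual ℝ E).symm (fderiv ℝ f z)

lemma norm_descentStep_sub_self (f : E → ℝ) {h : ℝ} (hh : 0 ≤ h) (z : E) :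
    ‖descentStep f h z - z‖ = h * ‖fderiv ℝ f z‖ := by
  simp [descentStep, norm_smul, abs_of_nonneg hh]

lemma fderiv_descentStep_sub_self (f : E → ℝ) (h : ℝ) (z : E) :
    fderiv ℝ f z (descentStep f h z - z) = -(h * ‖fderiv ℝ f z‖ ^ 2) := by
  set u := (InnerProductSpace.toDual ℝ E).symm (fderiv ℝ f z) with hu
  have h1 : fderiv ℝ f z = InnerProductSpace.toDual ℝ E u := by simp [hu]
  have h2 : descentStep f h z - z = -(h • u) := by simp [descentStep, hu]
  rw [h2, h1, map_neg, map_smul, InnerProductSpace.toDual_apply_apply, LinearIsometryEquiv.norm_map,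
    real_inner_self_eq_norm_sq, smul_eq_mul]

lemma continuous_descentStep {f : E → ℝ} (hf : ContDiff ℝ 2 f) (h : ℝ) :
    Continuous (descentStep f h) := by
  have : Continuous (fderiv ℝ f) := hf.continuous_fderiv (by norm_num)
  unfold descentStep
  fun_prop

/-- On a compact sublevel set, the gradient descent with a small step size decreases the
function, and its steps are small near critical points. -/
lemma exists_descent {f : E → ℝ} (hf : ContDiff ℝ 2 f) (hcoer : Tendsto f (cocompact E) atTop)
    (c : ℝ) : ∃ h > 0,
      (∀ z, f z ≤ c → f (descentStep f h z) ≤ f z - h / 2 * ‖fderiv ℝ f z‖ ^ 2) ∧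
      ∀ a z, f a ≤ c → f z ≤ c → fderiv ℝ f a = 0 →
        ‖descentStep f h z - z‖ ≤ ‖z - a‖ / 2 := by
  have hD2 : Continuous (fderiv ℝ (fderiv ℝ f)) :=
    (hf.fderiv_right (m := 1) (by norm_num)).continuous_fderiv (by norm_num)
  have hD1 : Continuous (fderiv ℝ f) := hf.continuous_fderiv (by norm_num)
  have hDd : Differentiable ℝ (fderiv ℝ f) :=
    (hf.fderiv_right (m := 1) (by norm_num)).differentiable (by norm_num)
  obtain ⟨R, hR⟩ : ∃ R, ∀ z, f z ≤ c → ‖z‖ ≤ R := by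
    have h1 := hcoer.eventually_gt_atTop c
    rw [← Metric.cobounded_eq_cocompact, ← comap_norm_atTop] at h1
    obtain ⟨s, hs, h2⟩ := h1
    obtain ⟨R, hR⟩ := mem_atTop_sets.1 hs
    refine ⟨R, fun z hz => ?_⟩
    by_contra! hlt
    exact absurd hz (not_le.2 (h2 (hR _ hlt.le)))
  obtain ⟨M, hM⟩ := (isCompact_closedBall (0 : E) R).exists_bound_of_continuousOn hD1.continuousOn
  -- Radius `R + 1` leaves room for one step of length at most `1` out of the sublevel set.
  obtain ⟨L, hL⟩ := (isCompact_closedBall (0 : E) (R + 1)).exists_bound_of_continuousOn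
    (E := E →L[ℝ] E →L[ℝ] ℝ) hD2.continuousOn
  have hlip : ∀ x ∈ Metric.closedBall (0 : E) (R + 1), ∀ y ∈ Metric.closedBall (0 : E) (R + 1),
      ‖fderiv ℝ f y - fderiv ℝ f x‖ ≤ L * ‖y - x‖ := fun x hx y hy =>
    (convex_closedBall (0 : E) (R + 1)).norm_image_sub_le_of_norm_fderiv_le
      (fun z _ => hDd z) hL hx hy
  have hd : 0 < 2 * (|M| + |L| + 1) := by positivity
  -- With this choice `h * M ≤ 1`, so a step stays in the larger ball, and `h * L ≤ 1 / 2`, so the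
  -- second-order error is at most half of the first-order gain. The `+ 1` keeps the denominator
  -- positive.
  refine ⟨1 / (2 * (|M| + |L| + 1)), by positivity, ?_, ?_⟩
  all_goals
    set h := 1 / (2 * (|M| + |L| + 1)) with hh
    have hpos : 0 < h := by positivity
    have hL2 : h * L ≤ 1 / 2 := by
      rw [hh, div_mul_eq_mul_div, one_mul, div_le_div_iff₀ hd (by norm_num)]
      linarith [le_abs_self L, abs_nonneg M]
    have hM2 : h * M ≤ 1 := by
      rw [hh, div_mul_eq_mul_div, one_mul, div_le_one hd]
      linarith [le_abs_self M, abs_nonneg L, abs_nonneg M]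
  · intro z hz
    have hzR := hR z hz
    have hzb : z ∈ Metric.closedBall (0 : E) R := by simpa using hzR
    set v := descentStep f h z - z with hv
    have hvn : ‖v‖ = h * ‖fderiv ℝ f z‖ := norm_descentStep_sub_self f hpos.le z
    have hv1 : ‖v‖ ≤ 1 := by
      rw [hvn]
      exact (mul_le_mul_of_nonneg_left (hM z hzb) hpos.le).trans hM2
    obtain ⟨t, ht, h1⟩ := exists_sub_eq_fderiv (hf.differentiable (by norm_num)) z v
    have htv : ‖t • v‖ ≤ ‖v‖ := by
      rw [norm_smul, Real.norm_eq_abs, abs_of_pos ht.1]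
      exact mul_le_of_le_one_left (norm_nonneg v) ht.2.le
    have h2 := hlip z (by simpa using hzR.trans (by linarith)) (z + t • v) (by
      have := norm_add_le z (t • v)
      simp only [mem_closedBall_zero_iff]
      linarith)
    rw [add_sub_cancel_left] at h2
    have h3 := ((fderiv ℝ f (z + t • v) - fderiv ℝ f z).le_opNorm v).trans'
      (Real.le_norm_self _)
    rw [sub_apply, fderiv_descentStep_sub_self] at h3
    have hL0 : 0 ≤ L := (norm_nonneg _).trans (hL z (by simpa using hzR.trans (by linarith)))
    have h4 : ‖fderiv ℝ f (z + t • v) - fderiv ℝ f z‖ * ‖v‖ ≤ L * ‖v‖ * ‖v‖ := by gcongr; nlinarith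
    have h5 : L * ‖v‖ * ‖v‖ ≤ h / 2 * ‖fderiv ℝ f z‖ ^ 2 := by
      rw [hvn]
      calc L * (h * ‖fderiv ℝ f z‖) * (h * ‖fderiv ℝ f z‖)
          = (h * L) * (h * ‖fderiv ℝ f z‖ ^ 2) := by ring
        _ ≤ 1 / 2 * (h * ‖fderiv ℝ f z‖ ^ 2) := by gcongr
        _ = _ := by ring
    have h6 : z + v = descentStep f h z := by simp [hv]
    rw [h6] at h1
    linarith
  · intro a z ha hz hcrit
    have h2 := hlip a (by simpa using (hR a ha).trans (by linarith)) z
      (by simpa using (hR z hz).trans (by linarith))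
    rw [hcrit, sub_zero] at h2
    rw [norm_descentStep_sub_self f hpos.le]
    calc h * ‖fderiv ℝ f z‖ ≤ h * (L * ‖z - a‖) := by gcongr
      _ = (h * L) * ‖z - a‖ := by ring
      _ ≤ 1 / 2 * ‖z - a‖ := by gcongr
      _ = _ := by ring

/-- The basin of attraction of a nondegenerate minimum contains a neighbourhood which is
invariant under gradient descent. -/
lemma exists_trap {f : E → ℝ} (hf : ContDiff ℝ 2 f) {c h : ℝ} {a : E}
    (hcrit : fderiv ℝ f a = 0) (ha : ∀ v, v ≠ 0 → 0 < fderiv ℝ (fderiv ℝ f) a v v)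
    (hdec : ∀ z, f z ≤ c → f (descentStep f h z) ≤ f z)
    (hstep : ∀ z, f z ≤ c → ‖descentStep f h z - z‖ ≤ ‖z - a‖ / 2) :
    ∃ V : Set E, IsOpen V ∧ a ∈ V ∧ (∀ z ∈ V, f z ≤ c → descentStep f h z ∈ V) ∧
      ∀ p ∈ closure V, fderiv ℝ f p = 0 → p = a := by
  obtain ⟨r, hr, hball⟩ := exists_ball_of_posDef hf hcrit ha
  -- `A` is a barrier: a closed shell on which `f` is bounded below by some `e > f a`.
  set A : Set E := Metric.closedBall a r \ Metric.ball a (r / 2) with hA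
  have hAc : IsCompact A := (isCompact_closedBall a r).diff Metric.isOpen_ball
  have hA' : ∀ z ∈ A, f a < f z := by
    rintro z ⟨hz1, hz2⟩
    rw [Metric.mem_closedBall, dist_eq_norm] at hz1
    refine (hball z hz1 ?_).2
    rintro rfl
    exact hz2 (Metric.mem_ball_self (by positivity))
  obtain ⟨e, he, hle⟩ : ∃ e, f a < e ∧ ∀ z ∈ A, e ≤ f z := by
    rcases A.eq_empty_or_nonempty with h0 | hne
    · exact ⟨f a + 1, by linarith, by simp [h0]⟩
    · obtain ⟨z, hz, hmin⟩ := hAc.exists_isMinOn hne hf.continuous.continuousOn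
      exact ⟨f z, hA' z hz, fun w hw => hmin hw⟩
  refine ⟨Metric.ball a (r / 2) ∩ {z | f z < e}, Metric.isOpen_ball.inter
    (isOpen_lt hf.continuous continuous_const), ⟨Metric.mem_ball_self (by positivity), he⟩, ?_, ?_⟩
  · rintro z ⟨hz, hze⟩ hzc
    have h1 : f (descentStep f h z) < e := (hdec z hzc).trans_lt hze
    refine ⟨?_, h1⟩
    -- A step from the ball of radius `r / 2` has length at most `r / 4`, so it cannot jump over the
    -- shell; landing in the shell contradicts `f < e`.
    by_contra hnot
    rw [Metric.mem_ball, dist_eq_norm] at hz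
    have h2 := norm_sub_le_norm_sub_add_norm_sub (descentStep f h z) z a
    have h3 := hstep z hzc
    refine absurd (hle _ ⟨?_, hnot⟩) (not_le.2 h1)
    rw [Metric.mem_closedBall, dist_eq_norm]
    linarith
  · intro p hp hp0
    have h1 : p ∈ Metric.closedBall a (r / 2) :=
      closure_minimal (inter_subset_left.trans Metric.ball_subset_closedBall)
        Metric.isClosed_closedBall hp
    by_contra hne
    rw [Metric.mem_closedBall, dist_eq_norm] at h1
    exact (hball p (by linarith) hne).1 hp0

/-- A coercive function all of whose critical points are nondegenerate minima has at most one
critical point. -/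
lemma eq_of_critical {f : E → ℝ} (hf : ContDiff ℝ 2 f) (hcoer : Tendsto f (cocompact E) atTop)
    (hpos : ∀ a, fderiv ℝ f a = 0 → ∀ v, v ≠ 0 → 0 < fderiv ℝ (fderiv ℝ f) a v v) {a b : E}
    (ha : fderiv ℝ f a = 0) (hb : fderiv ℝ f b = 0) : a = b := by
  have hsc : IsCompact (segment ℝ a b) := by
    rw [segment_eq_image_lineMap]
    exact isCompact_Icc.image AffineMap.lineMap_continuous
  -- Descent started anywhere on the segment stays in the compact sublevel set of `c`, where a
  -- single step size works.
  obtain ⟨c, hc⟩ := (hsc.bddAbove_image hf.continuous.continuousOn)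
  replace hc : ∀ z ∈ segment ℝ a b, f z ≤ c := fun z hz => hc (mem_image_of_mem f hz)
  obtain ⟨h, hh, hdec, hstep⟩ := exists_descent hf hcoer c
  have hdec' : ∀ z, f z ≤ c → f (descentStep f h z) ≤ f z := fun z hz =>
    (hdec z hz).trans (sub_le_self _ (by positivity))
  have hsub : ∀ n z, f z ≤ c → f ((descentStep f h)^[n] z) ≤ c := by
    intro n
    induction n with
    | zero => exact fun z hz => hz
    | succ n ih => exact fun z hz => ih _ ((hdec' z hz).trans hz)
  have hK : IsCompact {z | f z ≤ c} := by
    refine Metric.isCompact_of_isClosed_isBounded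
      (isClosed_le hf.continuous continuous_const) ?_
    have h1 := hcoer.eventually_gt_atTop c
    rw [← Metric.cobounded_eq_cocompact] at h1
    rw [Bornology.isBounded_def]
    filter_upwards [h1] with z hz
    simpa using hz
  -- every orbit accumulates at a critical point
  have hacc : ∀ z, f z ≤ c → ∃ p, fderiv ℝ f p = 0 ∧ f p ≤ c ∧
      ∃ φ : ℕ → ℕ, Tendsto (fun n => (descentStep f h)^[φ n] z) atTop (𝓝 p) := by
    intro z hz
    obtain ⟨p, hp, φ, hφ, hlim⟩ := hK.tendsto_subseq (x := fun n => (descentStep f h)^[n] z)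
      fun n => hsub n z hz
    refine ⟨p, ?_, hp, φ, hlim⟩
    have hanti : Antitone fun n => f ((descentStep f h)^[n] z) :=
      antitone_nat_of_succ_le fun n => by
        rw [Function.iterate_succ_apply']
        exact hdec' _ (hsub n z hz)
    have hf1 : Tendsto (fun n => f ((descentStep f h)^[φ n] z)) atTop (𝓝 (f p)) :=
      (hf.continuous.tendsto p).comp hlim
    -- Monotonicity extends convergence of the values from the subsequence to the whole orbit, hence
    -- to the successors of the subsequence.
    have hfl : Tendsto (fun n => f ((descentStep f h)^[n] z)) atTop (𝓝 (f p)) := by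
      rcases tendsto_atTop_of_antitone hanti with hbot | ⟨l, hl⟩
      · exact absurd (hbot.comp hφ.tendsto_atTop) (not_tendsto_atBot_of_tendsto_nhds hf1)
      · rwa [tendsto_nhds_unique hf1 (hl.comp hφ.tendsto_atTop)]
    have hf2 := (((tendsto_add_atTop_iff_nat 1).2 hfl).comp hφ.tendsto_atTop)
    have hg : Tendsto (fun n => ‖fderiv ℝ f ((descentStep f h)^[φ n] z)‖ ^ 2) atTop
        (𝓝 (‖fderiv ℝ f p‖ ^ 2)) := by
      have : Continuous fun z => ‖fderiv ℝ f z‖ ^ 2 :=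
        (hf.continuous_fderiv (by norm_num)).norm.pow 2
      exact (this.tendsto p).comp hlim
    -- The limit of the descent inequality reads `f p ≤ f p - h / 2 * ‖fderiv ℝ f p‖ ^ 2`.
    have hle := le_of_tendsto_of_tendsto' hf2 (hf1.sub (hg.const_mul (h / 2))) fun n => by
      simp only [Function.comp, Function.iterate_succ_apply']
      exact hdec _ (hsub _ z hz)
    have h0 : ‖fderiv ℝ f p‖ ^ 2 ≤ 0 := by
      by_contra! hlt
      nlinarith [mul_pos hh hlt]
    simpa using le_antisymm h0 (sq_nonneg _)
  have htrap : ∀ p : {p : E // fderiv ℝ f p = 0 ∧ f p ≤ c}, ∃ V : Set E, IsOpen V ∧ p.1 ∈ V ∧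
      (∀ z ∈ V, f z ≤ c → descentStep f h z ∈ V) ∧
      ∀ q ∈ closure V, fderiv ℝ f q = 0 → q = p.1 := fun p =>
    exists_trap hf p.2.1 (hpos p p.2.1) hdec' fun z hz => hstep p z p.2.2 hz p.2.1
  choose V hVo hpV hVinv hVcl using htrap
  have hVn : ∀ p n z, f z ≤ c → z ∈ V p → (descentStep f h)^[n] z ∈ V p := by
    intro p n
    induction n with
    | zero => exact fun z _ hz => hz
    | succ n ih => exact fun z hzc hz => ih _ ((hdec' z hzc).trans hzc) (hVinv p z hz hzc)
  -- An orbit lying in both traps accumulates at a critical point in both closures, which must equal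
  -- both `p` and `q`.
  have hVdisj : ∀ p q z, f z ≤ c → z ∈ V p → z ∈ V q → p = q := by
    intro p q z hz hzp hzq
    obtain ⟨l, hl, -, φ, hlim⟩ := hacc z hz
    have h1 := hVcl p l (mem_closure_of_tendsto hlim
      (Eventually.of_forall fun n => hVn p _ z hz hzp)) hl
    have h2 := hVcl q l (mem_closure_of_tendsto hlim
      (Eventually.of_forall fun n => hVn q _ z hz hzq)) hl
    exact Subtype.ext (h1.symm.trans h2)
  have hcont := continuous_descentStep hf h
  -- The basin of `p`: the points whose orbit enters the trap around `p`.
  set U : {p : E // fderiv ℝ f p = 0 ∧ f p ≤ c} → Set E :=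
    fun p => ⋃ n, (descentStep f h)^[n] ⁻¹' V p with hU
  have hUo : ∀ p, IsOpen (U p) := fun p =>
    isOpen_iUnion fun n => (hVo p).preimage (hcont.iterate n)
  have hpU : ∀ p, p.1 ∈ U p := fun p => mem_iUnion.2 ⟨0, hpV p⟩
  by_contra hne
  set pa : {p : E // fderiv ℝ f p = 0 ∧ f p ≤ c} := ⟨a, ha, hc a (left_mem_segment ℝ a b)⟩
  set pb : {p : E // fderiv ℝ f p = 0 ∧ f p ≤ c} := ⟨b, hb, hc b (right_mem_segment ℝ a b)⟩
  have hcover : segment ℝ a b ⊆ U pa ∪ ⋃ q ∈ {q | q ≠ pa}, U q := by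
    intro z hz
    obtain ⟨l, hl, hlc, φ, hlim⟩ := hacc z (hc z hz)
    obtain ⟨n, hn⟩ := (hlim.eventually ((hVo ⟨l, hl, hlc⟩).mem_nhds (hpV ⟨l, hl, hlc⟩))).exists
    have hzU : z ∈ U ⟨l, hl, hlc⟩ := mem_iUnion.2 ⟨φ n, hn⟩
    by_cases hla : (⟨l, hl, hlc⟩ : {p : E // fderiv ℝ f p = 0 ∧ f p ≤ c}) = pa
    · exact Or.inl (hla ▸ hzU)
    · exact Or.inr (mem_iUnion₂.2 ⟨_, hla, hzU⟩)
  obtain ⟨z, hz, hz1, hz2⟩ := (convex_segment a b).isPreconnected _ _ (hUo pa)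
    (isOpen_biUnion fun q _ => hUo q) hcover ⟨a, left_mem_segment ℝ a b, hpU pa⟩
    ⟨b, right_mem_segment ℝ a b, mem_iUnion₂.2
      ⟨pb, fun h => hne (congrArg Subtype.val h).symm, hpU pb⟩⟩
  obtain ⟨q, hq, hz2⟩ := mem_iUnion₂.1 hz2
  obtain ⟨n, hn⟩ := mem_iUnion.1 hz1
  obtain ⟨m, hm⟩ := mem_iUnion.1 hz2
  -- The orbit may enter the two traps at different times; by invariance both contain it at time `n
  -- + m`.
  have h1 := hVn pa m _ (hsub n z (hc z hz)) hn
  have h2 := hVn q n _ (hsub m z (hc z hz)) hm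
  rw [← Function.iterate_add_apply] at h1 h2
  rw [add_comm] at h2
  exact hq (hVdisj _ _ _ (hsub _ z (hc z hz)) h2 h1)

end Descent

/-! ### Derivatives of sums of affine compositions -/

section AffineComp

variable {E V : Type*} [NormedAddCommGroup E] [NormedSpace ℝ E] [NormedAddCommGroup V]
  [NormedSpace ℝ V]

lemma hasFDerivAt_sum_comp_affine {S : V → ℝ} (hS : ContDiff ℝ 2 S) {ι : Type*} (s : Finset ι)
    (c : ι → V) (M : ι → E →L[ℝ] V) (z : E) :
    HasFDerivAt (fun z => ∑ k ∈ s, S (c k + M k z))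
      (∑ k ∈ s, (fderiv ℝ S (c k + M k z)).comp (M k)) z :=
  HasFDerivAt.fun_sum fun k _ => (hS.differentiable (by norm_num) _).hasFDerivAt.comp z
    ((M k).hasFDerivAt.const_add (c k))

lemma fderiv_fderiv_sum_comp_affine {S : V → ℝ} (hS : ContDiff ℝ 2 S) {ι : Type*} (s : Finset ι)
    (c : ι → V) (M : ι → E →L[ℝ] V) (z v w : E) :
    fderiv ℝ (fderiv ℝ fun z => ∑ k ∈ s, S (c k + M k z)) z v w
      = ∑ k ∈ s, fderiv ℝ (fderiv ℝ S) (c k + M k z) (M k v) (M k w) := by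
  have hD : Differentiable ℝ (fderiv ℝ S) :=
    (hS.fderiv_right (m := 1) (by norm_num)).differentiable (by norm_num)
  have h1 : (fderiv ℝ fun z => ∑ k ∈ s, S (c k + M k z))
      = fun z => ∑ k ∈ s, (fderiv ℝ S (c k + M k z)).comp (M k) :=
    funext fun z => (hasFDerivAt_sum_comp_affine hS s c M z).fderiv
  have h2 : ∀ k, HasFDerivAt (fun z => (fderiv ℝ S (c k + M k z)).comp (M k)) _ z := fun k =>
    ((hD _).hasFDerivAt.comp z ((M k).hasFDerivAt.const_add (c k))).clm_comp
      (hasFDerivAt_const (M k) z)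
  rw [h1, (HasFDerivAt.fun_sum fun k _ => h2 k).fderiv]
  simp

/-- `eq_of_critical` does not depend on the inner product. -/
lemma eq_of_critical_of_finiteDimensional [FiniteDimensional ℝ E] {f : E → ℝ}
    (hf : ContDiff ℝ 2 f) (hcoer : Tendsto f (cocompact E) atTop)
    (hpos : ∀ a, fderiv ℝ f a = 0 → ∀ v, v ≠ 0 → 0 < fderiv ℝ (fderiv ℝ f) a v v) {a b : E}
    (ha : fderiv ℝ f a = 0) (hb : fderiv ℝ f b = 0) : a = b := by
  set e := (toEuclidean (E := E)).symm with he
  set L : EuclideanSpace ℝ (Fin (Module.finrank ℝ E)) →L[ℝ] E :=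
    e.toContinuousLinearMap with hL
  -- Viewed as a one-term sum, the composition is covered by the derivative formulas above.
  have hg : (fun z => f (L z)) = fun z => ∑ k ∈ ({()} : Finset Unit), f (0 + L z) := by simp
  have hd : ∀ z, fderiv ℝ (fun z => f (L z)) z = (fderiv ℝ f (L z)).comp L := fun z => by
    rw [hg, (hasFDerivAt_sum_comp_affine hf {()} (fun _ => 0) (fun _ => L) z).fderiv]
    simp
  have hcrit : ∀ z, fderiv ℝ (fun z => f (L z)) z = 0 ↔ fderiv ℝ f (L z) = 0 := fun z => by
    rw [hd]
    refine ⟨fun h => ?_, fun h => by rw [h, ContinuousLinearMap.zero_comp]⟩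
    ext v
    have := DFunLike.congr_fun h (e.symm v)
    simpa [hL] using this
  have hLe : ∀ a, L (e.symm a) = a := fun a => e.apply_symm_apply a
  have := eq_of_critical (f := fun z => f (L z)) (hf.comp L.contDiff)
    (hcoer.comp e.toHomeomorph.isClosedEmbedding.tendsto_cocompact) (fun z hz v hv => by
      rw [hg, fderiv_fderiv_sum_comp_affine hf {()} (fun _ => 0) (fun _ => L)]
      simpa using hpos (L z) ((hcrit z).1 hz) (L v) (by simpa [hL] using hv))
    (a := e.symm a) (b := e.symm b) ((hcrit _).2 (by rwa [hLe])) ((hcrit _).2 (by rwa [hLe]))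
  exact e.symm.injective this

end AffineComp

/-! ### Linearized twist map and Jacobi fields -/

variable {d : ℕ}

/-- The second differential of `S`, as a linear map from variations of `(x, y)` to variations of
`∂₁S`. -/
def dd₁ (S : Vec d × Vec d → ℝ) (x y ξ η : Vec d) : Covec d :=
  (fderiv ℝ (fderiv ℝ S) (x, y) (ξ, η)).comp (ContinuousLinearMap.inl ℝ (Vec d) (Vec d))

/-- The second differential of `S`, as a linear map from variations of `(x, y)` to variations of
`∂₂S`. -/
def dd₂ (S : Vec d × Vec d → ℝ) (x y ξ η : Vec d) : Covec d :=
  (fderiv ℝ (fderiv ℝ S) (x, y) (ξ, η)).comp (ContinuousLinearMap.inr ℝ (Vec d) (Vec d))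

lemma hasStrictFDerivAt_d₁ {S : Vec d × Vec d → ℝ} (hS : ContDiff ℝ 2 S) (x y : Vec d) :
    ∃ L : Vec d × Vec d →L[ℝ] Covec d,
      HasStrictFDerivAt (fun z : Vec d × Vec d => d₁ S z.1 z.2) L (x, y) ∧
      ∀ ξ η, L (ξ, η) = dd₁ S x y ξ η := by
  have hD : HasStrictFDerivAt (fderiv ℝ S) (fderiv ℝ (fderiv ℝ S) (x, y)) (x, y) :=
    (hS.fderiv_right (m := 1) (by norm_num)).contDiffAt.hasStrictFDerivAt (by norm_num)
  have h := hD.clm_comp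
    (hasStrictFDerivAt_const (ContinuousLinearMap.inl ℝ (Vec d) (Vec d)) (x, y))
  simp only [d₁_eq hS]
  refine ⟨_, h, fun ξ η => ?_⟩
  ext v
  simp [dd₁]

lemma hasStrictFDerivAt_d₂ {S : Vec d × Vec d → ℝ} (hS : ContDiff ℝ 2 S) (x y : Vec d) :
    ∃ L : Vec d × Vec d →L[ℝ] Covec d,
      HasStrictFDerivAt (fun z : Vec d × Vec d => d₂ S z.1 z.2) L (x, y) ∧
      ∀ ξ η, L (ξ, η) = dd₂ S x y ξ η := by
  have hD : HasStrictFDerivAt (fderiv ℝ S) (fderiv ℝ (fderiv ℝ S) (x, y)) (x, y) :=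
    (hS.fderiv_right (m := 1) (by norm_num)).contDiffAt.hasStrictFDerivAt (by norm_num)
  have h := hD.clm_comp
    (hasStrictFDerivAt_const (ContinuousLinearMap.inr ℝ (Vec d) (Vec d)) (x, y))
  simp only [d₂_eq hS]
  refine ⟨_, h, fun ξ η => ?_⟩
  ext v
  simp [dd₂]

namespace GeneratingFunction

variable (G : GeneratingFunction d)

lemma snd_fderiv_symm (x y : Vec d) (v w : Vec d × Vec d) :
    fderiv ℝ (fderiv ℝ G.S) (x, y) v w = fderiv ℝ (fderiv ℝ G.S) (x, y) w v :=
  (G.contDiff.contDiffAt.isSymmSndFDerivAt (x := (x, y)) (by simp)).eq v w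

lemma snd_fderiv_twist : ∃ A : ℝ, 0 < A ∧ ∀ x y ξ : Vec d,
    fderiv ℝ (fderiv ℝ G.S) (x, y) (ξ, 0) (0, ξ) ≤ -A * ‖ξ‖ ^ 2 := by
  obtain ⟨A, hA, h⟩ := G.twist
  refine ⟨A, hA, fun x y ξ => ?_⟩
  rw [← fderiv_d₂ G.contDiff, ← sum_mixedPartial G.contDiff]
  exact h x y ξ

lemma eq_zero_of_snd_fderiv {x y ξ : Vec d}
    (h : fderiv ℝ (fderiv ℝ G.S) (x, y) (ξ, 0) (0, ξ) = 0) : ξ = 0 := by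
  obtain ⟨A, hA, hle⟩ := G.snd_fderiv_twist
  have := hle x y ξ
  rw [h] at this
  by_contra hne
  have hpos : 0 < ‖ξ‖ := norm_pos_iff.2 hne
  nlinarith [mul_pos hA (pow_pos hpos 2)]

/-- The twist condition makes the mixed second derivative definite, hence injective; symmetry
exchanges the two variables. -/
lemma eq_zero_of_dd₁ {x y η : Vec d} (h : dd₁ G.S x y 0 η = 0) : η = 0 := by
  refine G.eq_zero_of_snd_fderiv (x := x) (y := y) ?_
  rw [G.snd_fderiv_symm]
  exact DFunLike.congr_fun h η

lemma eq_zero_of_dd₂ {x y ξ : Vec d} (h : dd₂ G.S x y ξ 0 = 0) : ξ = 0 :=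
  G.eq_zero_of_snd_fderiv (x := x) (y := y) (DFunLike.congr_fun h ξ)

lemma next_neg_d₁ (x y : Vec d) : G.next x (-d₁ G.S x y) = y :=
  (G.bijective_d₁ x).injective (by simp [G.d₁_next])

/-- The differential of the lifted twist map. -/
lemma hasFDerivAt_liftedMap (z : Vec d × Covec d) :
    ∃ L : Vec d × Covec d →L[ℝ] Vec d × Covec d, HasFDerivAt G.liftedMap L z ∧
      Function.Injective L ∧ ∀ ξ η, L (ξ, -dd₁ G.S z.1 (G.next z.1 z.2) ξ η)
        = (η, dd₂ G.S z.1 (G.next z.1 z.2) ξ η) := by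
  obtain ⟨x, p⟩ := z
  obtain ⟨y, rfl⟩ : ∃ y, p = -d₁ G.S x y := ⟨G.next x p, by rw [G.d₁_next, neg_neg]⟩
  simp only [next_neg_d₁]
  obtain ⟨L₁, hL₁, hL₁'⟩ := hasStrictFDerivAt_d₁ G.contDiff x y
  obtain ⟨L₂, hL₂, hL₂'⟩ := hasStrictFDerivAt_d₂ G.contDiff x y
  -- The pairs `(x, y)` of consecutive points parametrize the graph of `F̄`: the map is `ψ ∘ φ⁻¹`
  -- with `φ = (x, -∂₁S)` and `ψ = (y, ∂₂S)`. The twist condition makes both differentials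
  -- injective, and `G.next` supplies the inverse of `φ`.
  have hφ : HasStrictFDerivAt (fun z : Vec d × Vec d => (z.1, -d₁ G.S z.1 z.2))
      ((ContinuousLinearMap.fst ℝ (Vec d) (Vec d)).prod (-L₁)) (x, y) :=
    hasStrictFDerivAt_fst.prodMk hL₁.neg
  have hψ : HasStrictFDerivAt (fun z : Vec d × Vec d => (z.2, d₂ G.S z.1 z.2))
      ((ContinuousLinearMap.snd ℝ (Vec d) (Vec d)).prod L₂) (x, y) :=
    hasStrictFDerivAt_snd.prodMk hL₂
  have hinj : Function.Injective
      ((ContinuousLinearMap.fst ℝ (Vec d) (Vec d)).prod (-L₁) :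
        Vec d × Vec d →ₗ[ℝ] Vec d × Covec d) := by
    rw [injective_iff_map_eq_zero]
    rintro ⟨ξ, η⟩ h
    have h1 : ξ = 0 := congrArg Prod.fst h
    have h2 : -L₁ (ξ, η) = 0 := congrArg Prod.snd h
    rw [hL₁', h1, neg_eq_zero] at h2
    rw [h1, G.eq_zero_of_dd₁ h2]
    rfl
  have hdim : Module.finrank ℝ (Vec d × Vec d) = Module.finrank ℝ (Vec d × Covec d) := by
    have : Module.finrank ℝ (Vec d) = Module.finrank ℝ (Covec d) :=
      (InnerProductSpace.toDual ℝ (Vec d)).toLinearEquiv.finrank_eq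
    rw [Module.finrank_prod, Module.finrank_prod, this]
  set e : (Vec d × Vec d) ≃L[ℝ] Vec d × Covec d :=
    (LinearEquiv.ofInjectiveOfFinrankEq _ hinj hdim).toContinuousLinearEquiv with he
  have he' : (e : Vec d × Vec d →L[ℝ] Vec d × Covec d)
      = (ContinuousLinearMap.fst ℝ (Vec d) (Vec d)).prod (-L₁) :=
    ContinuousLinearMap.ext fun _ => rfl
  rw [← he'] at hφ
  have hinv := hφ.to_local_left_inverse (g := fun z => (z.1, G.next z.1 z.2))
    (Eventually.of_forall fun z => by simp [next_neg_d₁])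
  have hψ' : HasStrictFDerivAt (fun z : Vec d × Vec d => (z.2, d₂ G.S z.1 z.2))
      ((ContinuousLinearMap.snd ℝ (Vec d) (Vec d)).prod L₂) (x, G.next x (-d₁ G.S x y)) := by
    rwa [next_neg_d₁]
  refine ⟨_, (hψ'.comp (x, -d₁ G.S x y) hinv).hasFDerivAt, ?_, fun ξ η => ?_⟩
  · refine Function.Injective.comp (g := (ContinuousLinearMap.snd ℝ (Vec d) (Vec d)).prod L₂) ?_
      e.symm.injective
    rw [injective_iff_map_eq_zero]
    rintro ⟨ξ, η⟩ h
    have h1 : η = 0 := congrArg Prod.fst h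
    have h2 : L₂ (ξ, η) = 0 := congrArg Prod.snd h
    rw [hL₂', h1] at h2
    rw [h1, G.eq_zero_of_dd₂ h2]
    rfl
  · have : e.symm (ξ, -dd₁ G.S x y ξ η) = (ξ, η) := by
      rw [ContinuousLinearEquiv.symm_apply_eq]
      change _ = (e : Vec d × Vec d →L[ℝ] Vec d × Covec d) (ξ, η)
      rw [he', ← hL₁']
      rfl
    change ((ContinuousLinearMap.snd ℝ (Vec d) (Vec d)).prod L₂) (e.symm _) = _
    rw [this, ← hL₂']
    rfl

/-- The orbit of `z` under the lifted twist map, projected to `ℝ^d`. -/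
def orbit (z : Vec d × Covec d) (k : ℕ) : Vec d := ((G.liftedMap)^[k] z).1

lemma next_iterate (z : Vec d × Covec d) (k : ℕ) :
    G.next (G.orbit z k) ((G.liftedMap)^[k] z).2 = G.orbit z (k + 1) := by
  rw [orbit, orbit, Function.iterate_succ_apply']
  rfl

/-- Jacobi fields along the orbit of `z`, between the times `0` and `n + 1`. -/
def IsJacobi (u : ℕ → Vec d) (n : ℕ) (ξ : ℕ → Vec d) : Prop :=
  ∀ k < n, dd₂ G.S (u k) (u (k + 1)) (ξ k) (ξ (k + 1))
    + dd₁ G.S (u (k + 1)) (u (k + 2)) (ξ (k + 1)) (ξ (k + 2)) = 0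

/-- The Jacobi equation says that the momentum variation `dd₂` arriving at a point equals the
variation `-dd₁` leaving it, so the chain rule transports Jacobi fields. Injectivity is recorded to
recover an initial vector from its image. -/
lemma hasFDerivAt_iterate (z : Vec d × Covec d) (n : ℕ) :
    ∃ L : Vec d × Covec d →L[ℝ] Vec d × Covec d, HasFDerivAt (G.liftedMap)^[n + 1] L z ∧
      Function.Injective L ∧ ∀ ξ, G.IsJacobi (G.orbit z) n ξ →
        L (ξ 0, -dd₁ G.S (G.orbit z 0) (G.orbit z 1) (ξ 0) (ξ 1))
          = (ξ (n + 1), dd₂ G.S (G.orbit z n) (G.orbit z (n + 1)) (ξ n) (ξ (n + 1))) := by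
  induction n with
  | zero =>
    obtain ⟨L, hL, hinj, h⟩ := G.hasFDerivAt_liftedMap z
    exact ⟨L, hL, hinj, fun ξ _ => h (ξ 0) (ξ 1)⟩
  | succ n ih =>
    obtain ⟨L, hL, hinj, h⟩ := ih
    obtain ⟨L', hL', hinj', h'⟩ := G.hasFDerivAt_liftedMap ((G.liftedMap)^[n + 1] z)
    refine ⟨L'.comp L, ?_, hinj'.comp hinj, fun ξ hξ => ?_⟩
    · rw [Function.iterate_succ']
      exact hL'.comp z hL
    · rw [ContinuousLinearMap.comp_apply, h ξ fun k hk => hξ k (hk.trans n.lt_succ_self),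
        eq_neg_of_add_eq_zero_left (hξ n n.lt_succ_self)]
      have := h' (ξ (n + 1)) (ξ (n + 2))
      rw [show G.next ((G.liftedMap)^[n + 1] z).1 ((G.liftedMap)^[n + 1] z).2 = G.orbit z (n + 2)
        from G.next_iterate z (n + 1)] at this
      exact this

lemma twistMap_zpow_proj (n : ℕ) (z : Vec d × Covec d) :
    (G.twistMap ^ (n : ℤ)) (proj z) = proj ((G.liftedMap)^[n] z) := by
  rw [zpow_natCast]
  induction n with
  | zero => rfl
  | succ n ih =>
    rw [pow_succ', Equiv.Perm.mul_apply, ih, G.twistMap_proj, Function.iterate_succ_apply']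

/-- Without conjugate points, there are no nontrivial Jacobi fields vanishing at both ends. -/
lemma NoConjugatePoints.jacobi_eq_zero {G : GeneratingFunction d} (hG : G.NoConjugatePoints)
    (z : Vec d × Covec d) (n : ℕ) {ξ : ℕ → Vec d} (hξ : G.IsJacobi (G.orbit z) n ξ)
    (h0 : ξ 0 = 0) (hn : ξ (n + 1) = 0) : ∀ k ≤ n + 1, ξ k = 0 := by
  obtain ⟨L, hL, hinj, h⟩ := G.hasFDerivAt_iterate z n
  have hdiff : HasDifferentialAt (⇑(G.twistMap ^ ((n + 1 : ℕ) : ℤ))) (proj z) L :=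
    ⟨z, (G.liftedMap)^[n + 1], rfl,
      Eventually.of_forall fun w => (G.twistMap_zpow_proj (n + 1) w).symm, hL⟩
  have hbot := hG (proj z) ((n + 1 : ℕ) : ℤ) (by exact_mod_cast n.succ_ne_zero) L hdiff
  have hLξ := h ξ hξ
  rw [h0, hn] at hLξ
  -- The initial vector of the Jacobi field is vertical because `ξ 0 = 0`, and so is its image
  -- because `ξ (n + 1) = 0`.
  set q : Vec d × Covec d := (0, -dd₁ G.S (G.orbit z 0) (G.orbit z 1) 0 (ξ 1)) with hq
  have hmem : L q ∈ (⊥ : Submodule ℝ (Vec d × Covec d)) := by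
    rw [← hbot]
    refine ⟨?_, Submodule.mem_map_of_mem (f := (L : Vec d × Covec d →ₗ[ℝ] Vec d × Covec d)) ?_⟩
    · rw [hLξ]
      simp [vertical]
    · simp [vertical, hq]
  have hq0 : q = 0 := hinj (by rw [(Submodule.mem_bot ℝ).1 hmem, map_zero])
  have h1 : ξ 1 = 0 := G.eq_zero_of_dd₁ (neg_eq_zero.1 (congrArg Prod.snd hq0))
  -- The Jacobi equation is a second-order recurrence, solvable for its last term by the twist
  -- condition: two consecutive zeros propagate.
  have key : ∀ k ≤ n, ξ k = 0 ∧ ξ (k + 1) = 0 := by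
    intro k
    induction k with
    | zero => exact fun _ => ⟨h0, h1⟩
    | succ k ih =>
      intro hk
      obtain ⟨h2, h3⟩ := ih (by omega)
      refine ⟨h3, ?_⟩
      have h4 := hξ k (by omega)
      rw [h2, h3] at h4
      refine G.eq_zero_of_dd₁ (x := G.orbit z (k + 1)) (y := G.orbit z (k + 2)) ?_
      rwa [show dd₂ G.S (G.orbit z k) (G.orbit z (k + 1)) 0 0 = 0 by
        rw [dd₂, show ((0 : Vec d), (0 : Vec d)) = 0 from rfl, map_zero,
          ContinuousLinearMap.zero_comp], zero_add] at h4
  intro k hk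
  rcases Nat.eq_zero_or_pos k with rfl | hpos
  · exact h0
  · obtain ⟨m, rfl⟩ := Nat.exists_eq_succ_of_ne_zero hpos.ne'
    exact (key m (by omega)).2

lemma continuous_orbit (k : ℕ) : Continuous fun z => G.orbit z k := by
  have : Continuous G.liftedMap := continuous_iff_continuousAt.2 fun z =>
    let ⟨_, hL, _⟩ := G.hasFDerivAt_liftedMap z
    hL.continuousAt
  exact continuous_fst.comp (this.iterate k)

end GeneratingFunction

/-! ### Coercivity -/

/-- Each point is a lattice translate of a point of the compact unit cube. -/
lemma exists_bound_of_periodic {F : Type*} [SeminormedAddCommGroup F] {g : Vec d → F}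
    (hg : Continuous g) (hper : ∀ (r : Fin d → ℤ) u, g (u + intVec r) = g u) :
    ∃ C, ∀ u, ‖g u‖ ≤ C := by
  have hK : IsCompact (WithLp.toLp 2 '' Icc (0 : Fin d → ℝ) 1 : Set (Vec d)) :=
    isCompact_Icc.image (PiLp.continuous_toLp 2 _)
  obtain ⟨C, hC⟩ := hK.exists_bound_of_continuousOn hg.continuousOn
  refine ⟨C, fun u => ?_⟩
  have hu : u = WithLp.toLp 2 (fun i => Int.fract (u i)) + intVec fun i => ⌊u i⌋ := by
    ext i
    simp [intVec]
  rw [hu, hper]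
  exact hC _ (mem_image_of_mem _ ⟨fun i => Int.fract_nonneg _, fun i => (Int.fract_lt_one _).le⟩)

namespace GeneratingFunction

variable (G : GeneratingFunction d)

lemma d₂_monotone : ∃ A : ℝ, 0 < A ∧ ∀ x y v : Vec d,
    d₂ G.S (x + v) y v - d₂ G.S x y v ≤ -A * ‖v‖ ^ 2 := by
  obtain ⟨A, hA, h⟩ := G.snd_fderiv_twist
  refine ⟨A, hA, fun x y v => ?_⟩
  have hdiff : Differentiable ℝ (fun u => d₂ G.S u y) :=
    ((contDiff_d₂ G.contDiff).comp (contDiff_id.prodMk contDiff_const)).differentiable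
      (by norm_num)
  obtain ⟨t, -, ht⟩ := exists_sub_eq_fderiv (f := fun u => d₂ G.S u y v)
    (hdiff.clm_apply (differentiable_const v)) x v
  rw [ht, ((hdiff _).hasFDerivAt.clm_apply (hasFDerivAt_const v _)).fderiv]
  have := h (x + t • v) y v
  rw [← fderiv_d₂ G.contDiff] at this
  simpa using this

/-- The generating function grows at least linearly off the diagonal. -/
lemma exists_norm_sub_le : ∃ C : ℝ, ∀ x y : Vec d, dist x y - C ≤ G.S (x, y) := by
  obtain ⟨A, hA, hmono⟩ := G.d₂_monotone
  obtain ⟨C₀, hC₀⟩ := exists_bound_of_periodic (g := fun u => G.S (u, u))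
    (G.contDiff.continuous.comp (continuous_id.prodMk continuous_id)) fun r u => G.periodic r u u
  obtain ⟨C₁, hC₁⟩ := exists_bound_of_periodic (g := fun u => d₂ G.S u u)
    ((contDiff_d₂ G.contDiff).continuous.comp (continuous_id.prodMk continuous_id))
    fun r u => G.d₂_periodic r u u
  -- The estimate obtained is `S (x, x + v) ≥ A / 2 * ‖v‖ ^ 2 - C₁ * ‖v‖ - C₀`; subtracting `‖v‖`
  -- and completing the square leaves this constant.
  refine ⟨C₀ + (C₁ + 1) ^ 2 / (2 * A), fun x y => ?_⟩
  obtain ⟨v, rfl⟩ : ∃ v, y = x + v := ⟨y - x, by abel⟩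
  have hd : ∀ t : ℝ, HasDerivAt
      (fun t : ℝ => G.S (x, x + t • v) + t * (C₁ * ‖v‖) - t ^ 2 * (A / 2 * ‖v‖ ^ 2))
      (d₂ G.S x (x + t • v) v + C₁ * ‖v‖ - 2 * t * (A / 2 * ‖v‖ ^ 2)) t := by
    intro t
    have h1 := hasDerivAt_lineMap (f := fun y => G.S (x, y))
      ((G.contDiff.comp (contDiff_const.prodMk contDiff_id)).differentiable (by norm_num)) x v t
    have h2 := (hasDerivAt_id t).mul_const (C₁ * ‖v‖)
    have h3 := (hasDerivAt_pow 2 t).mul_const (A / 2 * ‖v‖ ^ 2)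
    exact ((h1.add h2).sub h3).congr_deriv (by simp [d₂])
  have hm : MonotoneOn
      (fun t : ℝ => G.S (x, x + t • v) + t * (C₁ * ‖v‖) - t ^ 2 * (A / 2 * ‖v‖ ^ 2))
      (Icc 0 1) := by
    refine monotoneOn_of_deriv_nonneg (convex_Icc 0 1)
      (fun t _ => (hd t).continuousAt.continuousWithinAt)
      (fun t _ => (hd t).differentiableAt.differentiableWithinAt) fun t ht => ?_
    rw [interior_Icc] at ht
    rw [(hd t).deriv]
    -- Moving the first variable onto the diagonal, where `∂₂S` is bounded by periodicity, gains `A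
    -- * t * ‖v‖ ^ 2`.
    have h1 := hmono x (x + t • v) (t • v)
    rw [map_smul, map_smul, norm_smul, Real.norm_eq_abs, abs_of_pos ht.1, smul_eq_mul,
      smul_eq_mul] at h1
    have h2 : d₂ G.S (x + t • v) (x + t • v) v - d₂ G.S x (x + t • v) v ≤ -A * t * ‖v‖ ^ 2 := by
      refine le_of_mul_le_mul_left ?_ ht.1
      calc _ = _ := mul_sub _ _ _
        _ ≤ _ := h1
        _ = _ := by ring
    have h3 := (d₂ G.S (x + t • v) (x + t • v)).le_of_opNorm_le (hC₁ _) v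
    have h4 := neg_abs_le (d₂ G.S (x + t • v) (x + t • v) v)
    rw [← Real.norm_eq_abs] at h4
    linarith
  have h1 := hm (left_mem_Icc.2 zero_le_one) (right_mem_Icc.2 zero_le_one) zero_le_one
  have h2 := neg_abs_le (G.S (x, x))
  have h3 := hC₀ x
  rw [Real.norm_eq_abs] at h3
  simp only [zero_smul, add_zero, zero_mul, one_smul, one_mul, one_pow, sub_zero, ne_eq,
    OfNat.ofNat_ne_zero, not_false_eq_true, zero_pow] at h1
  rw [dist_self_add_right]
  have h4 : A / 2 * ‖v‖ ^ 2 - (C₁ + 1) * ‖v‖ + (C₁ + 1) ^ 2 / (2 * A)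
      = A / 2 * (‖v‖ - (C₁ + 1) / A) ^ 2 := by
    field_simp
    ring
  have h5 : 0 ≤ A / 2 * (‖v‖ - (C₁ + 1) / A) ^ 2 := by positivity
  linarith

end GeneratingFunction

/-! ### The differentials of the action -/

lemma path_zero (x y : Vec d) (N : ℕ) (z : Fin (N - 1) → Vec d) : path x y N z 0 = x := by
  simp [path]

lemma path_self (x y : Vec d) {N : ℕ} (hN : 1 ≤ N) (z : Fin (N - 1) → Vec d) :
    path x y N z N = y := by
  simp [path, show N ≠ 0 by omega]

lemma path_succ (x y : Vec d) (N : ℕ) (z : Fin (N - 1) → Vec d) (j : Fin (N - 1)) :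
    path x y N z (j + 1) = z j := by
  simp [path]

/-- The linear part of `path`. -/
def pathVar (d N k : ℕ) : (Fin (N - 1) → Vec d) →L[ℝ] Vec d :=
  if k = 0 then 0 else if h : k - 1 < N - 1 then ContinuousLinearMap.proj ⟨k - 1, h⟩ else 0

lemma path_eq_add (x y : Vec d) (N : ℕ) (z : Fin (N - 1) → Vec d) (k : ℕ) :
    path x y N z k = path x y N 0 k + pathVar d N k z := by
  unfold path pathVar
  split_ifs <;> simp

lemma pathVar_zero (N : ℕ) : pathVar d N 0 = 0 := by
  simp [pathVar]

lemma pathVar_self (N : ℕ) : pathVar d N N = 0 := by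
  simp [pathVar]

lemma pathVar_succ (N : ℕ) (j : Fin (N - 1)) (w : Fin (N - 1) → Vec d) :
    pathVar d N (j + 1) w = w j := by
  simp [pathVar]

/-- Summation by parts. -/
lemma sum_pathVar (a b : ℕ → Covec d) {N : ℕ} (hN : 1 ≤ N) (w : Fin (N - 1) → Vec d) :
    ∑ k ∈ Finset.range N, (a k (pathVar d N k w) + b k (pathVar d N (k + 1) w))
      = ∑ j : Fin (N - 1), (b j + a (j + 1)) (w j) := by
  obtain ⟨n, rfl⟩ := Nat.exists_eq_add_of_le' hN
  rw [Finset.sum_add_distrib, Finset.sum_range_succ', pathVar_zero, Finset.sum_range_succ,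
    pathVar_self, zero_apply, map_zero, map_zero, add_zero, add_zero, add_comm,
    ← Finset.sum_add_distrib, Finset.sum_range]
  refine Finset.sum_congr rfl fun j _ => ?_
  rw [add_apply]
  congr 2 <;> exact pathVar_succ (n + 1) j w

/-- Serves twice: with first differentials it yields the extremality equations, with second
differentials the Jacobi equations. -/
lemma sum_pathVar_eq_zero_iff (a b : ℕ → Covec d) {N : ℕ} (hN : 1 ≤ N) :
    (∀ w, ∑ k ∈ Finset.range N, (a k (pathVar d N k w) + b k (pathVar d N (k + 1) w)) = 0)
      ↔ ∀ k < N - 1, b k + a (k + 1) = 0 := by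
  simp only [sum_pathVar a b hN]
  constructor
  · intro h k hk
    ext v
    have := h (Pi.single ⟨k, hk⟩ v)
    rw [Finset.sum_eq_single ⟨k, hk⟩ (fun j _ hj => by rw [Pi.single_eq_of_ne hj, map_zero])
      (by simp), Pi.single_eq_same] at this
    exact this
  · intro h w
    exact Finset.sum_eq_zero fun j _ => by rw [h j j.2, zero_apply]

/-- The linear part of a pair of consecutive points of `path`. -/
def pairVar (d N k : ℕ) : (Fin (N - 1) → Vec d) →L[ℝ] Vec d × Vec d :=
  (pathVar d N k).prod (pathVar d N (k + 1))

lemma fixedAction_eq (S : Vec d × Vec d → ℝ) (x y : Vec d) (N : ℕ) :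
    fixedAction S x y N = fun z => ∑ k ∈ Finset.range N,
      S ((path x y N 0 k, path x y N 0 (k + 1)) + pairVar d N k z) := by
  funext z
  refine Finset.sum_congr rfl fun k _ => ?_
  rw [path_eq_add x y N z k, path_eq_add x y N z (k + 1)]
  rfl

lemma pair_eq (x y : Vec d) (N : ℕ) (z : Fin (N - 1) → Vec d) (k : ℕ) :
    (path x y N 0 k, path x y N 0 (k + 1)) + pairVar d N k z
      = (path x y N z k, path x y N z (k + 1)) := by
  rw [path_eq_add x y N z k, path_eq_add x y N z (k + 1)]
  rfl

lemma contDiff_fixedAction {S : Vec d × Vec d → ℝ} (hS : ContDiff ℝ 2 S) (x y : Vec d) (N : ℕ) :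
    ContDiff ℝ 2 (fixedAction S x y N) := by
  rw [fixedAction_eq]
  exact ContDiff.sum fun k _ => hS.comp (contDiff_const.add (pairVar d N k).contDiff)

lemma clm_prod_apply (L : Vec d × Vec d →L[ℝ] ℝ) (v w : Vec d) :
    L (v, w) = L.comp (ContinuousLinearMap.inl ℝ _ _) v
      + L.comp (ContinuousLinearMap.inr ℝ _ _) w := by
  simp [← map_add]

lemma isCriticalPoint_iff_fderiv {S : Vec d × Vec d → ℝ} (hS : ContDiff ℝ 2 S) (x y : Vec d)
    (N : ℕ) (z : Fin (N - 1) → Vec d) :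
    IsCriticalPoint (fixedAction S x y N) z ↔ fderiv ℝ (fixedAction S x y N) z = 0 :=
  ⟨fun h => h.fderiv, fun h => by
    have := ((contDiff_fixedAction hS x y N).differentiable (by norm_num) z).hasFDerivAt
    rwa [h] at this⟩

/-- Finite extremal sequences. -/
def IsExtremalUpTo (S : Vec d × Vec d → ℝ) (p : ℕ → Vec d) (N : ℕ) : Prop :=
  ∀ k < N - 1, d₂ S (p k) (p (k + 1)) + d₁ S (p (k + 1)) (p (k + 2)) = 0

lemma fderiv_fixedAction_eq_zero_iff {S : Vec d × Vec d → ℝ} (hS : ContDiff ℝ 2 S) (x y : Vec d)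
    {N : ℕ} (hN : 1 ≤ N) (z : Fin (N - 1) → Vec d) :
    fderiv ℝ (fixedAction S x y N) z = 0 ↔ IsExtremalUpTo S (path x y N z) N := by
  unfold IsExtremalUpTo
  rw [← sum_pathVar_eq_zero_iff (fun k => d₁ S (path x y N z k) (path x y N z (k + 1)))
    (fun k => d₂ S (path x y N z k) (path x y N z (k + 1))) hN, ContinuousLinearMap.ext_iff,
    fixedAction_eq, (hasFDerivAt_sum_comp_affine hS _ _ _ z).fderiv]
  refine forall_congr' fun w => ?_
  rw [zero_apply, sum_apply]
  refine Eq.congr_left (Finset.sum_congr rfl fun k _ => ?_)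
  rw [pair_eq, d₁_eq hS, d₂_eq hS]
  exact clm_prod_apply _ _ _

/-- The Hessian of the action along a sequence. -/
def actionHessian (S : Vec d × Vec d → ℝ) (N : ℕ) (p : ℕ → Vec d) :
    (Fin (N - 1) → Vec d) →L[ℝ] (Fin (N - 1) → Vec d) →L[ℝ] ℝ :=
  ∑ k ∈ Finset.range N,
    (fderiv ℝ (fderiv ℝ S) (p k, p (k + 1))).bilinearComp (pairVar d N k) (pairVar d N k)

lemma actionHessian_apply (S : Vec d × Vec d → ℝ) (N : ℕ) (p : ℕ → Vec d)
    (v w : Fin (N - 1) → Vec d) : actionHessian S N p v w = ∑ k ∈ Finset.range N,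
      fderiv ℝ (fderiv ℝ S) (p k, p (k + 1)) (pairVar d N k v) (pairVar d N k w) := by
  simp [actionHessian]

lemma fderiv_fderiv_fixedAction {S : Vec d × Vec d → ℝ} (hS : ContDiff ℝ 2 S) (x y : Vec d)
    (N : ℕ) (z v w : Fin (N - 1) → Vec d) :
    fderiv ℝ (fderiv ℝ (fixedAction S x y N)) z v w
      = actionHessian S N (path x y N z) v w := by
  rw [fixedAction_eq, fderiv_fderiv_sum_comp_affine hS, actionHessian_apply]
  simp only [pair_eq]

lemma actionHessian_congr (S : Vec d × Vec d → ℝ) (N : ℕ) {p q : ℕ → Vec d}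
    (h : ∀ k ≤ N, p k = q k) : actionHessian S N p = actionHessian S N q := by
  refine Finset.sum_congr rfl fun k hk => ?_
  rw [Finset.mem_range] at hk
  rw [h k hk.le, h (k + 1) hk]

namespace GeneratingFunction

variable (G : GeneratingFunction d)

lemma actionHessian_symm (N : ℕ) (p : ℕ → Vec d) (v w : Fin (N - 1) → Vec d) :
    actionHessian G.S N p v w = actionHessian G.S N p w v := by
  simp only [actionHessian_apply]
  exact Finset.sum_congr rfl fun k _ => G.snd_fderiv_symm _ _ _ _

/-- The forms of orbits with different endpoints live on one space of interior variations, so they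
form a single family over the connected phase space. -/
lemma continuous_actionHessian (N : ℕ) :
    Continuous fun z => actionHessian G.S N (G.orbit z) := by
  have hD2 : Continuous (fderiv ℝ (fderiv ℝ G.S)) :=
    (G.contDiff.fderiv_right (m := 1) (by norm_num)).continuous_fderiv (by norm_num)
  refine continuous_clm_apply.2 fun v => continuous_clm_apply.2 fun w => ?_
  simp only [actionHessian_apply]
  refine continuous_finsetSum _ fun k _ => ?_
  have h1 : Continuous fun z => fderiv ℝ (fderiv ℝ G.S) (G.orbit z k, G.orbit z (k + 1)) :=
    hD2.comp ((G.continuous_orbit k).prodMk (G.continuous_orbit (k + 1)))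
  exact (h1.clm_apply continuous_const).clm_apply continuous_const

lemma isJacobi_of_actionHessian {N : ℕ} (hN : 1 ≤ N) (p : ℕ → Vec d) {v : Fin (N - 1) → Vec d}
    (h : actionHessian G.S N p v = 0) :
    G.IsJacobi p (N - 1) fun k => pathVar d N k v := by
  refine (sum_pathVar_eq_zero_iff
    (fun k => dd₁ G.S (p k) (p (k + 1)) (pathVar d N k v) (pathVar d N (k + 1) v))
    (fun k => dd₂ G.S (p k) (p (k + 1)) (pathVar d N k v) (pathVar d N (k + 1) v)) hN).1
      fun w => ?_
  have := DFunLike.congr_fun h w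
  rw [actionHessian_apply] at this
  simp only [pairVar, ContinuousLinearMap.prod_apply, clm_prod_apply, zero_apply] at this
  exact this

lemma NoConjugatePoints.eq_zero_of_actionHessian {G : GeneratingFunction d}
    (hG : G.NoConjugatePoints) {N : ℕ} (hN : 1 ≤ N) (z : Vec d × Covec d)
    {v : Fin (N - 1) → Vec d} (h : actionHessian G.S N (G.orbit z) v = 0) : v = 0 := by
  have hj := hG.jacobi_eq_zero z (N - 1) (G.isJacobi_of_actionHessian hN _ h)
    (by simp [pathVar_zero]) (by rw [Nat.sub_add_cancel hN]; simp [pathVar_self])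
  funext j
  rw [← pathVar_succ N j v]
  exact hj _ (by omega)

/-- The linear lower bound on `S` makes the action control the length of the path, and this length
bounds the distance of each interior point from `x`. -/
lemma tendsto_fixedAction (x y : Vec d) {N : ℕ} (hN : 1 ≤ N) :
    Tendsto (fixedAction G.S x y N) (cocompact _) atTop := by
  obtain ⟨C, hC⟩ := G.exists_norm_sub_le
  have hlow : ∀ z, ∑ k ∈ Finset.range N, dist (path x y N z k) (path x y N z (k + 1)) - N * C
      ≤ fixedAction G.S x y N z := by
    intro z
    have := Finset.sum_le_sum (s := Finset.range N)
      fun k _ => hC (path x y N z k) (path x y N z (k + 1))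
    rwa [Finset.sum_sub_distrib, Finset.sum_const, Finset.card_range, nsmul_eq_mul] at this
  refine tendsto_atTop_mono (f := fun z => ‖z‖ + (-(N * C) - ‖x‖)) (fun z => ?_)
    (tendsto_atTop_add_const_right _ _ (tendsto_norm_cocompact_atTop (E := Fin (N - 1) → Vec d)))
  suffices ‖z‖ ≤ fixedAction G.S x y N z + N * C + ‖x‖ by linarith
  have h0 : 0 ≤ ∑ k ∈ Finset.range N, dist (path x y N z k) (path x y N z (k + 1)) :=
    Finset.sum_nonneg fun _ _ => dist_nonneg
  have h1 := hlow z
  refine (pi_norm_le_iff_of_nonneg (by linarith [norm_nonneg x])).2 fun j => ?_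
  have h2 := dist_le_range_sum_dist (path x y N z) (j + 1)
  rw [path_zero, path_succ] at h2
  have h3 : ∑ k ∈ Finset.range (j + 1), dist (path x y N z k) (path x y N z (k + 1))
      ≤ ∑ k ∈ Finset.range N, dist (path x y N z k) (path x y N z (k + 1)) :=
    Finset.sum_le_sum_of_subset_of_nonneg (Finset.range_mono (by omega))
      fun _ _ _ => dist_nonneg
  have h4 : ‖z j‖ ≤ ‖x‖ + dist x (z j) := by
    rw [dist_comm, dist_eq_norm]
    exact norm_le_norm_add_norm_sub' (z j) x
  linarith

/-! ### Extremal sequences are orbits -/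

lemma liftedMap_of_extremal {a b c : Vec d} (h : d₂ G.S a b + d₁ G.S b c = 0) :
    G.liftedMap (a, -d₁ G.S a b) = (b, -d₁ G.S b c) :=
  (G.liftedMap_eq_iff _ _ _ _).2 ⟨rfl, (eq_neg_of_add_eq_zero_left h).symm⟩

lemma orbit_eq_of_isExtremalUpTo {p : ℕ → Vec d} {N : ℕ} (hN : 1 ≤ N)
    (hp : IsExtremalUpTo G.S p N) : ∀ k ≤ N, G.orbit (p 0, -d₁ G.S (p 0) (p 1)) k = p k := by
  have key : ∀ k < N, (G.liftedMap)^[k] (p 0, -d₁ G.S (p 0) (p 1))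
      = (p k, -d₁ G.S (p k) (p (k + 1))) := by
    intro k
    induction k with
    | zero => exact fun _ => rfl
    | succ k ih =>
      intro hk
      rw [Function.iterate_succ_apply', ih (by omega), G.liftedMap_of_extremal (hp k (by omega))]
  intro k hk
  rcases Nat.eq_zero_or_pos k with rfl | hpos
  · rfl
  · obtain ⟨m, rfl⟩ := Nat.exists_eq_succ_of_ne_zero hpos.ne'
    -- The last point has no constrained successor, so its momentum is not available in `key`; its
    -- position comes from the pair before it.
    rw [← G.next_iterate, orbit, key m hk]
    exact G.next_neg_d₁ _ _

/-- The bi-infinite orbit of `z` under the lifted twist map, projected to `ℝ^d`. -/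
def fullOrbit (z : Vec d × Covec d) (n : ℤ) : Vec d := ((G.liftedMap ^ n) z).1

lemma fullOrbit_natCast (z : Vec d × Covec d) (k : ℕ) : G.fullOrbit z k = G.orbit z k := by
  rw [fullOrbit, zpow_natCast, orbit, Equiv.Perm.iterate_eq_pow]

lemma isExtremal_fullOrbit (z : Vec d × Covec d) : IsExtremal G.S (G.fullOrbit z) := by
  have hstep : ∀ n : ℤ, ((G.liftedMap ^ n) z).2 = -d₁ G.S (G.fullOrbit z n) (G.fullOrbit z (n + 1))
      ∧ ((G.liftedMap ^ (n + 1)) z).2 = d₂ G.S (G.fullOrbit z n) (G.fullOrbit z (n + 1)) := by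
    intro n
    refine (G.liftedMap_eq_iff _ _ _ _).1 ?_
    have : (G.liftedMap ^ (n + 1)) z = G.liftedMap ((G.liftedMap ^ n) z) := by
      rw [add_comm, zpow_one_add, Equiv.Perm.mul_apply]
    exact this.symm
  intro n
  have h1 := (hstep (n - 1)).2
  rw [sub_add_cancel] at h1
  rw [← h1, (hstep n).1, neg_add_cancel]

lemma eq_fullOrbit_of_isExtremal {u : ℤ → Vec d} (hu : IsExtremal G.S u) :
    u = G.fullOrbit (u 0, -d₁ G.S (u 0) (u 1)) := by
  have hstep : ∀ n : ℤ, G.liftedMap (u n, -d₁ G.S (u n) (u (n + 1)))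
      = (u (n + 1), -d₁ G.S (u (n + 1)) (u (n + 1 + 1))) := by
    intro n
    have := hu (n + 1)
    rw [add_sub_cancel_right] at this
    exact G.liftedMap_of_extremal this
  have key : ∀ n : ℤ, (G.liftedMap ^ n) (u 0, -d₁ G.S (u 0) (u 1))
      = (u n, -d₁ G.S (u n) (u (n + 1))) := by
    intro n
    induction n with
    | zero => rfl
    | succ n ih => rw [add_comm, zpow_one_add, Equiv.Perm.mul_apply, ih, hstep, add_comm 1]
    | pred n ih =>
      rw [← G.liftedMap.injective.eq_iff, hstep, sub_add_cancel, ← ih, ← Equiv.Perm.mul_apply, ← zpow_one_add,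
        add_sub_cancel]
  funext n
  rw [fullOrbit, key]

/-! ### Uniqueness -/

/-- The case `N = 1`, where there are no interior points, is kept for the statement on extremal
sequences. -/
theorem NoConjugatePoints.exists_unique_critical {G : GeneratingFunction d}
    (hG : G.NoConjugatePoints) (x y : Vec d) {N : ℕ} (hN : 1 ≤ N) :
    ∃ z, IsCriticalPoint (fixedAction G.S x y N) z ∧
      (∀ w, IsCriticalPoint (fixedAction G.S x y N) w → w = z) ∧
      ∀ w, fixedAction G.S x y N z ≤ fixedAction G.S x y N w := by
  have hf := contDiff_fixedAction G.contDiff x y N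
  have hcoer := G.tendsto_fixedAction x y hN
  obtain ⟨m, hm⟩ := hf.continuous.exists_forall_le hcoer
  have hm0 : fderiv ℝ (fixedAction G.S x y N) m = 0 :=
    IsLocalMin.fderiv_eq_zero (Eventually.of_forall hm)
  have hess : ∀ z, fderiv ℝ (fixedAction G.S x y N) z = 0 → ∃ ω, ∀ v w,
      fderiv ℝ (fderiv ℝ (fixedAction G.S x y N)) z v w
        = actionHessian G.S N (G.orbit ω) v w := by
    intro z hz
    have h1 := G.orbit_eq_of_isExtremalUpTo hN
      ((fderiv_fixedAction_eq_zero_iff G.contDiff x y hN z).1 hz)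
    refine ⟨(path x y N z 0, -d₁ G.S (path x y N z 0) (path x y N z 1)), fun v w => ?_⟩
    rw [fderiv_fderiv_fixedAction G.contDiff, actionHessian_congr G.S N h1]
  obtain ⟨ω₀, hω₀⟩ := hess m hm0
  -- Semidefiniteness at the one orbit `ω₀` of the minimum propagates to all orbits, whatever their
  -- endpoints.
  have hpos := posDef_of_preconnected (fun ω => actionHessian G.S N (G.orbit ω))
    (G.continuous_actionHessian N) (fun ω => G.actionHessian_symm N _)
    (fun ω v hv => hG.eq_zero_of_actionHessian hN ω hv) (x₀ := ω₀)
    fun v => hω₀ v v ▸ hessian_nonneg_of_min hf hm v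
  refine ⟨m, (isCriticalPoint_iff_fderiv G.contDiff x y N m).2 hm0, fun w hw => ?_, hm⟩
  refine eq_of_critical_of_finiteDimensional hf hcoer (fun a ha v hv => ?_)
    ((isCriticalPoint_iff_fderiv G.contDiff x y N w).1 hw) hm0
  obtain ⟨ω, hω⟩ := hess a ha
  rw [hω]
  exact hpos ω v hv

lemma path_eq_of_isExtremal {u : ℤ → Vec d} {x y : Vec d} {N : ℕ} (hN : 1 ≤ N) (hx : u 0 = x)
    (hy : u N = y) (k : ℕ) (hk : k ≤ N) :
    path x y N (fun j => u ((j + 1 : ℕ) : ℤ)) k = u k := by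
  rcases Nat.eq_zero_or_pos k with rfl | hpos
  · rw [path_zero, ← hx]
    rfl
  · rcases hk.eq_or_lt with rfl | hlt
    · rw [path_self _ _ hN, hy]
    · obtain ⟨m, rfl⟩ := Nat.exists_eq_succ_of_ne_zero hpos.ne'
      exact path_succ x y N (fun j => u ((j + 1 : ℕ) : ℤ)) ⟨m, by omega⟩

lemma isExtremalUpTo_of_isExtremal {u : ℤ → Vec d} (hu : IsExtremal G.S u) {x y : Vec d} {N : ℕ}
    (hN : 1 ≤ N) (hx : u 0 = x) (hy : u N = y) :
    IsExtremalUpTo G.S (path x y N fun j => u ((j + 1 : ℕ) : ℤ)) N := by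
  intro k hk
  rw [path_eq_of_isExtremal hN hx hy k (by omega),
    path_eq_of_isExtremal hN hx hy (k + 1) (by omega),
    path_eq_of_isExtremal hN hx hy (k + 2) (by omega)]
  have := hu (k + 1)
  rw [add_sub_cancel_right, add_assoc, one_add_one_eq_two] at this
  exact_mod_cast this

theorem NoConjugatePoints.existsUnique_extremal {G : GeneratingFunction d}
    (hG : G.NoConjugatePoints) (x y : Vec d) {N : ℕ} (hN : 1 ≤ N) :
    ∃! u : ℤ → Vec d, IsExtremal G.S u ∧ u 0 = x ∧ u N = y := by
  obtain ⟨z, hz, huniq, -⟩ := hG.exists_unique_critical x y hN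
  simp only [isCriticalPoint_iff_fderiv G.contDiff,
    fderiv_fixedAction_eq_zero_iff G.contDiff x y hN] at hz huniq
  have horb := G.orbit_eq_of_isExtremalUpTo hN hz
  refine ⟨G.fullOrbit (path x y N z 0, -d₁ G.S (path x y N z 0) (path x y N z 1)),
    ⟨G.isExtremal_fullOrbit _, path_zero x y N z, ?_⟩, ?_⟩
  · rw [fullOrbit_natCast, horb N le_rfl, path_self _ _ hN]
  · rintro u ⟨hu, hx, hy⟩
    -- The interior of `u` is the unique critical point, so `u 0` and `u 1` are prescribed, and they
    -- determine the whole sequence.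
    have hp : ∀ k ≤ N, path x y N z k = u k := fun k hk => by
      rw [← huniq _ (G.isExtremalUpTo_of_isExtremal hu hN hx hy)]
      exact path_eq_of_isExtremal hN hx hy k hk
    rw [hp 0 (Nat.zero_le N), hp 1 hN]
    exact G.eq_fullOrbit_of_isExtremal hu

end GeneratingFunction

end TwistMap

end

theorem proposition1p4 (d : ℕ) (hd : 1 ≤ d) (G : TwistMap.GeneratingFunction d)
    (hG : G.NoConjugatePoints) :
    (∀ (x y : TwistMap.Vec d) (N : ℕ), 2 ≤ N →
      ∃ z : Fin (N - 1) → TwistMap.Vec d,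
        TwistMap.IsCriticalPoint (TwistMap.fixedAction G.S x y N) z ∧
        (∀ w, TwistMap.IsCriticalPoint (TwistMap.fixedAction G.S x y N) w → w = z) ∧
        (∀ w, TwistMap.fixedAction G.S x y N z ≤ TwistMap.fixedAction G.S x y N w)) ∧
    (∀ (x y : TwistMap.Vec d) (N : ℕ), 1 ≤ N →
      ∃! u : ℤ → TwistMap.Vec d, TwistMap.IsExtremal G.S u ∧ u 0 = x ∧ u N = y) :=
  ⟨fun x y _ hN => hG.exists_unique_critical x y (one_le_two.trans hN),
    fun x y _ hN => hG.existsUnique_extremal x y hN⟩
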